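/- Let $d,T\ge 1$ and let $G_1,\dots,G_T$ be independent standard Gaussian vectors in $\mathbb R^d$ on a standard Borel probability space, $\mathcal G_t=\sigma(G_1,\dots,G_t)$. Let $\mathbf L$ be the space of block-lower triangular matrices $L=(L_{t,s})_{s,t=1}^T\in\mathbb R^{dT\times dT}$ with blocks in $\mathbb R^{d\times d}$, with the Frobenius norm $\|\cdot\|_{\rm F}$, let $\mathbf O$ be the set of block-diagonal matrices with orthogonal $d\times d$ diagonal blocks, and write $[L]=\{LO:O\in\mathbf O\}\in\mathbf L/_{\mathbf O}$. Let $$d_{\rm ABW}(L,M)=\mathcal{AW}_2(LG,MG),\qquad \mathcal{AW}_2^2(X,Y)=\inf_{X'\sim_{\rm ad}X,\;Y'\sim_{\rm ad}Y}\mathbb E\big[|X'-Y'|^2\big],$$ where $X',Y'$ range over square-integrable $(\mathcal G_t)$-adapted processes and $Z\sim_{\rm ad}Z'$ means that the nested laws $\mathrm{law}(\mathrm{law}(\cdots\mathrm{law}(Z\mid\mathcal G_{T-1})\cdots\mid\mathcal G_1))$ of $Z$ and $Z'$ coincide. The same symbol denotes the induced distance on $\mathbf L/_{\mathbf O}$.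 Let $\Gamma([L])$ be the set of constant speed $d_{\rm ABW}$-geodesics $\gamma:[0,1]\to\mathbf L/_{\mathbf O}$ with $\gamma(0)=[L]$. For non-constant $\gamma,\eta\in\Gamma([L])$ the angle $\angle(\gamma,\eta)\in[0,\pi]$ is given by $$\cos\angle(\gamma,\eta)=\lim_{u\downarrow0}\frac{d_{\rm ABW}^2([L],\gamma(u))+d_{\rm ABW}^2([L],\eta(u))-d_{\rm ABW}^2(\gamma(u),\eta(u))}{2\,d_{\rm ABW}([L],\gamma(u))\,d_{\rm ABW}([L],\eta(u))}.$$ The tangent cone $\mathbf T([L])$ is the metric cone over the completion of the non-constant elements of $\Gamma([L])$ modulo $\angle=0$: its points are the pairs $(\theta,r)$, $r\ge0$, with all $(\theta,0)$ identified, and $d_{\mathbf T([L])}^2((\theta,r),(\varphi,s))=r^2+s^2-2rs\cos\angle(\theta,\varphi)$. The initial velocity of a non-constant $\eta\in\Gamma([L])$ is $([\eta]_\angle,d_{\rm ABW}([L],\eta(1)))$, that of the constant geodesic is the tip of the cone. The partially defined map $\exp_{[L]}:\mathbf T([L])\to\mathbf L/_{\mathbf O}$ sends $\xi$ to $\eta(1)$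 if there is exactly one $\eta\in\Gamma([L])$ with initial velocity $\xi$, and is undefined at $\xi$ otherwise. For $L\in\mathbf L$ let $\mathcal V(L)=\{V\in\mathbf L:(V^\top L)_{t,t}\text{ is symmetric for all }t\}$, let $\mathbf O^*(L,M)$ be the set of minimizers of $O\mapsto\|L-MO\|_{\rm F}$ over $\mathbf O$, and $\mathbf V(L)=\{MP-L:M\in\mathbf L,\ P\in\mathbf O^*(L,M)\}$. Call $L\in\mathbf L$ regular, $L\in\mathbf L^{\rm reg}$, if $(L^\top L)_{t,t}$ is positive definite for all $t=1,\dots,T$. **Proposition.** Let $L\in\mathbf L^{\rm reg}$. There is exactly one bijection $\iota_L:\mathbf T([L])\to\mathcal V(L)$ such that $$\iota_L\big(([\gamma]_\angle,r)\big)=\frac{r}{\|V\|_{\rm F}}\,V\qquad(r\ge0)$$ whenever $V\in\mathbf V(L)\setminus\{0\}$ and $\gamma\in\Gamma([L])$ is a non-constant geodesic with $\gamma(u)=[L+uV]$ for all $u\in[0,1]$. It is an isometry from $(\mathbf T([L]),d_{\mathbf T([L])})$ onto $(\mathcal V(L),\|\cdot\|_{\rm F})$, and for every $V\in\mathcal V(L)$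 there is $r_0>0$ such that for all $r\in[0,r_0]$ the exponential map $\exp_{[L]}$ is defined at $\iota_L^{-1}(rV)$ and $$\exp_{[L]}\big(\iota_L^{-1}(rV)\big)=[L+rV].$$ -/

import Mathlib

open MeasureTheory ProbabilityTheory Filter Topology
open scoped NNReal Matrix.Norms.Frobenius

noncomputable section

namespace ABW

/-! ### Block matrices -/

/-- Real `dT × dT` matrices; the index `(t, i)` is the `i`-th row (column) of the `t`-th block.
The norm on matrices used throughout is the Frobenius norm. -/
abbrev Mat (d T : ℕ) := Matrix (Fin T × Fin d) (Fin T × Fin d) ℝ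

/-- The space `𝐋` of block-lower triangular matrices. -/
def lowerBlock (d T : ℕ) : Submodule ℝ (Mat d T) where
  carrier := {A | ∀ p q : Fin T × Fin d, p.1 < q.1 → A p q = 0}
  add_mem' hA hB p q h := by simp [hA p q h, hB p q h]
  zero_mem' p q _ := rfl
  smul_mem' c A hA p q h := by simp [hA p q h]

/-- The diagonal block `A_{t,t}`. -/
def diagBlock {d T : ℕ} (A : Mat d T) (t : Fin T) : Matrix (Fin d) (Fin d) ℝ :=
  Matrix.of fun i j => A (t, i) (t, j)

/-- The block-diagonal matrix `diag(O_1, …, O_T)`. -/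
def blockDiag {d T : ℕ} (O : Fin T → Matrix (Fin d) (Fin d) ℝ) : Mat d T :=
  Matrix.of fun p q => if p.1 = q.1 then O p.1 p.2 q.2 else 0

/-- The set `𝐎` of block-diagonal matrices with orthogonal diagonal blocks. -/
def blockOrth (d T : ℕ) : Set (Mat d T) :=
  {A | ∃ O : Fin T → Matrix (Fin d) (Fin d) ℝ,
    (∀ t, O t ∈ Matrix.orthogonalGroup (Fin d) ℝ) ∧ A = blockDiag O}

lemma blockDiag_one {d T : ℕ} :
    blockDiag (fun _ : Fin T => (1 : Matrix (Fin d) (Fin d) ℝ)) = 1 := by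
  ext ⟨t, i⟩ ⟨s, j⟩
  by_cases h : t = s <;> by_cases h' : i = j <;> simp [blockDiag, Matrix.one_apply, h, h']

lemma blockDiag_mul {d T : ℕ} (O P : Fin T → Matrix (Fin d) (Fin d) ℝ) :
    blockDiag O * blockDiag P = blockDiag (fun t => O t * P t) := by
  ext ⟨t, i⟩ ⟨s, j⟩
  simp only [blockDiag, Matrix.mul_apply, Matrix.of_apply, Fintype.sum_prod_type]
  rw [Finset.sum_eq_single t]
  · by_cases h : t = s <;> simp [h]
  · intro b _ hb
    simp [hb.symm]
  · simp

lemma one_mem_blockOrth (d T : ℕ) : (1 : Mat d T) ∈ blockOrth d T :=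
  ⟨fun _ => 1, fun _ => one_mem _, blockDiag_one.symm⟩

lemma mul_mem_blockOrth {d T : ℕ} {A B : Mat d T} (hA : A ∈ blockOrth d T)
    (hB : B ∈ blockOrth d T) : A * B ∈ blockOrth d T := by
  obtain ⟨O, hO, rfl⟩ := hA
  obtain ⟨P, hP, rfl⟩ := hB
  exact ⟨_, fun t => mul_mem (hO t) (hP t), blockDiag_mul O P⟩

lemma exists_inv_blockOrth {d T : ℕ} {A : Mat d T} (hA : A ∈ blockOrth d T) :
    ∃ B ∈ blockOrth d T, A * B = 1 := by
  obtain ⟨O, hO, rfl⟩ := hA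
  refine ⟨_, ⟨fun t => star (O t), fun t => Unitary.star_mem (hO t), rfl⟩, ?_⟩
  rw [blockDiag_mul, ← blockDiag_one]
  congr 1
  funext t
  exact Unitary.mul_star_self_of_mem (hO t)

/-- `L ∼ M` iff `L = M O` for some `O ∈ 𝐎`. -/
instance orthSetoid (d T : ℕ) : Setoid (lowerBlock d T) where
  r L M := ∃ O ∈ blockOrth d T, (L : Mat d T) = (M : Mat d T) * O
  iseqv :=
    { refl := fun L => ⟨1, one_mem_blockOrth d T, by simp⟩
      symm := by
        rintro L M ⟨O, hO, h⟩
        obtain ⟨B, hB, hOB⟩ := exists_inv_blockOrth hO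
        exact ⟨B, hB, by rw [h, Matrix.mul_assoc, hOB, Matrix.mul_one]⟩
      trans := by
        rintro L M N ⟨O, hO, h⟩ ⟨P, hP, h'⟩
        exact ⟨P * O, mul_mem_blockOrth hP hO, by rw [h, h', Matrix.mul_assoc]⟩ }

/-- The quotient `𝐋/𝐎`. -/
def Space (d T : ℕ) : Type := Quotient (orthSetoid d T)

/-- The class `[L]`. -/
def toClass {d T : ℕ} (L : lowerBlock d T) : Space d T := Quotient.mk _ L

/-- `L ∈ 𝐋^reg`: all the diagonal blocks `(Lᵀ L)_{t,t}` are positive definite. -/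
def IsReg {d T : ℕ} (L : lowerBlock d T) : Prop :=
  ∀ t, (diagBlock ((L : Mat d T).transpose * (L : Mat d T)) t).PosDef

/-- The linear space `𝒱(L)` of all `V ∈ 𝐋` such that every `(Vᵀ L)_{t,t}` is symmetric. -/
def calV {d T : ℕ} (L : lowerBlock d T) : Submodule ℝ (lowerBlock d T) where
  carrier := {V | ∀ t, (diagBlock ((V : Mat d T).transpose * (L : Mat d T)) t).IsSymm}
  add_mem' {A B} hA hB t := by
    have h := (hA t).add (hB t)
    convert h using 1
    ext i j
    simp [diagBlock, Matrix.add_mul]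
  zero_mem' t := by
    ext i j
    simp [diagBlock]
  smul_mem' c A hA t := by
    have h := (hA t).smul c
    convert h using 1
    ext i j
    simp [diagBlock]

/-- The set `𝐎*(L, M)` of minimisers of `O ↦ ‖L - M O‖` over `𝐎`. -/
def optOrth {d T : ℕ} (L M : lowerBlock d T) : Set (Mat d T) :=
  {O | O ∈ blockOrth d T ∧ ∀ O' ∈ blockOrth d T,
    ‖(L : Mat d T) - (M : Mat d T) * O‖ ≤ ‖(L : Mat d T) - (M : Mat d T) * O'‖}

/-- The set `𝐕(L) = {M P - L : M ∈ 𝐋, P ∈ 𝐎*(L, M)}`. -/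
def bfV {d T : ℕ} (L : lowerBlock d T) : Set (lowerBlock d T) :=
  {V | ∃ M : lowerBlock d T, ∃ P ∈ optOrth L M,
    (V : Mat d T) = (M : Mat d T) * P - (L : Mat d T)}

/-! ### Nested laws and the adapted Wasserstein distance -/

/-- The path space `(ℝ^d)^T`. -/
abbrev Path (d T : ℕ) := Fin T → EuclideanSpace ℝ (Fin d)

/-- A stochastic basis: a probability measure on `Ω` together with `T` independent `d`-dimensional
standard Gaussian random vectors. -/
structure GaussianBasis (d T : ℕ) (Ω : Type*) [MeasurableSpace Ω] where
  /-- the probability measure -/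
  P : Measure Ω
  isProb : IsProbabilityMeasure P
  /-- the Gaussian vectors -/
  G : Fin T → Ω → EuclideanSpace ℝ (Fin d)
  measurable_G : ∀ t, Measurable (G t)
  law_G : ∀ t, P.map (G t) = stdGaussian (EuclideanSpace ℝ (Fin d))
  indep_G : iIndepFun G P

attribute [instance] GaussianBasis.isProb

/-- The spaces in which iterated conditional laws live: the path space, measures on it, measures on
measures on it, and so on. -/
def nestedSpace (d T : ℕ) : ℕ → (α : Type) × MeasurableSpace α
  | 0 => ⟨Path d T, inferInstance⟩
  | k + 1 => ⟨@Measure (nestedSpace d T k).1 (nestedSpace d T k).2,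
      @Measure.instMeasurableSpace (nestedSpace d T k).1 (nestedSpace d T k).2⟩

instance (d T k : ℕ) : MeasurableSpace (nestedSpace d T k).1 := (nestedSpace d T k).2

variable {d T : ℕ} {Ω : Type*} [MeasurableSpace Ω]

/-- `B.filt n` is the σ-algebra generated by the first `n` Gaussian vectors. -/
@[reducible]
def GaussianBasis.filt (B : GaussianBasis d T Ω) (n : ℕ) : MeasurableSpace Ω :=
  ⨆ s : Fin T, ⨆ _ : (s : ℕ) < n, MeasurableSpace.comap (B.G s) inferInstance

/-- Square-integrable processes adapted to the Gaussian filtration. -/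
def GaussianBasis.L2ad (B : GaussianBasis d T Ω) : Set (Ω → Path d T) :=
  {Z | ∀ t : Fin T, Measurable[B.filt (t + 1)] (fun ω => Z ω t) ∧
    MemLp (fun ω => Z ω t) 2 B.P}

/-- Iterated regular conditional laws: `condNest Z 0 = Z`, and `condNest Z (k+1)` is the conditional
law of `condNest Z k` given the σ-algebra of the first `T - 1 - k` Gaussian vectors. -/
def GaussianBasis.condNest [StandardBorelSpace Ω] (B : GaussianBasis d T Ω) (Z : Ω → Path d T) :
    (k : ℕ) → Ω → (nestedSpace d T k).1
  | 0 => Z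
  | k + 1 => fun ω =>
      ((condExpKernel B.P (B.filt (T - 1 - k)) ω).map (B.condNest Z k) :
        Measure (nestedSpace d T k).1)

/-- The nested law `law(law(… law(Z | 𝓖_{T-1}) … | 𝓖_1))`. -/
def GaussianBasis.nestedLaw [StandardBorelSpace Ω] (B : GaussianBasis d T Ω) (Z : Ω → Path d T) :
    Measure (nestedSpace d T (T - 1)).1 :=
  B.P.map (B.condNest Z (T - 1))

/-- The adapted Wasserstein distance: the square root of the infimum of `E |X' - Y'|²` over adapted
square-integrable `X'`, `Y'` with the same nested laws as `X`, `Y`. -/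
def GaussianBasis.AW [StandardBorelSpace Ω] (B : GaussianBasis d T Ω) (X Y : Ω → Path d T) : ℝ :=
  √(sInf {c : ℝ | ∃ X' ∈ B.L2ad, ∃ Y' ∈ B.L2ad,
    B.nestedLaw X' = B.nestedLaw X ∧ B.nestedLaw Y' = B.nestedLaw Y ∧
    c = ∫ ω, ∑ t, ‖X' ω t - Y' ω t‖ ^ 2 ∂B.P})

/-- The Gaussian process `L G`, i.e. `(L G)_t = ∑_{s ≤ t} L_{t,s} G_s`. -/
def GaussianBasis.process (B : GaussianBasis d T Ω) (L : lowerBlock d T) : Ω → Path d T :=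
  fun ω t => WithLp.toLp 2 fun i => ∑ s : Fin T, ∑ j : Fin d, (L : Mat d T) (t, i) (s, j) * B.G s ω j

variable [StandardBorelSpace Ω]

/-- `d_ABW(L, M)`, the adapted Wasserstein distance of the processes `L G` and `M G`. -/
def dABW (B : GaussianBasis d T Ω) (L M : lowerBlock d T) : ℝ :=
  B.AW (B.process L) (B.process M)

/-- The quotient distance on `𝐋/𝐎`: the infimum of `d_ABW` over all representatives (as `d_ABW` does
not depend on the representatives, this is its common value on them). -/
def qdist (B : GaussianBasis d T Ω) (x y : Space d T) : ℝ :=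
  sInf {c : ℝ | ∃ L M : lowerBlock d T, toClass L = x ∧ toClass M = y ∧ c = dABW B L M}

/-! ### Geodesics, angles, directions, tangent cones -/

/-- `Γ(x)`: constant speed geodesics `[0,1] → 𝐋/𝐎` starting at `x`. -/
def Geod (B : GaussianBasis d T Ω) (x : Space d T) : Type :=
  {γ : unitInterval → Space d T //
    γ 0 = x ∧ ∀ u v : unitInterval, qdist B (γ u) (γ v) = |(u : ℝ) - v| * qdist B (γ 0) (γ 1)}

/-- The geodesic with zero speed. -/
def IsConst {B : GaussianBasis d T Ω} {x : Space d T} (γ : Geod B x) : Prop := ∀ u, γ.1 u = x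

/-- `Γ(x) \ {0}`. -/
def NCGeod (B : GaussianBasis d T Ω) (x : Space d T) : Type := {γ : Geod B x // ¬ IsConst γ}

/-- The comparison cosine `α(x, y, z)`. -/
def compCos (B : GaussianBasis d T Ω) (x y z : Space d T) : ℝ :=
  (qdist B x y ^ 2 + qdist B x z ^ 2 - qdist B y z ^ 2) / (2 * qdist B x y * qdist B x z)

/-- The angle: `cos ∠(γ, η) = lim_{u ↓ 0} α(x, γ(u), η(u))`. -/
def angle {B : GaussianBasis d T Ω} {x : Space d T} (γ η : NCGeod B x) : ℝ :=
  Real.arccos (limUnder (𝓝[>] (0 : unitInterval)) fun u => compCos B x (γ.1.1 u) (η.1.1 u))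

/-- Sequences in `Γ(x) \ {0}` that are Cauchy for the angle. -/
def CauchyDir (B : GaussianBasis d T Ω) (x : Space d T) : Type :=
  {s : ℕ → NCGeod B x // ∀ ε > 0, ∃ N, ∀ m ≥ N, ∀ n ≥ N, angle (s m) (s n) < ε}

/-- The space of directions at `x`: the completion of `(Γ(x) \ {0})/∠` for the angle, realised as
Cauchy sequences modulo sequences whose mutual angle tends to zero. -/
def Dir (B : GaussianBasis d T Ω) (x : Space d T) : Type :=
  Quot fun s t : CauchyDir B x => Tendsto (fun n => angle (s.1 n) (t.1 n)) atTop (𝓝 0)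

/-- The angle extended to the completion, as a limit along representing Cauchy sequences. -/
def Dir.angle {B : GaussianBasis d T Ω} {x : Space d T} (θ φ : Dir B x) : ℝ :=
  limUnder atTop fun n => ABW.angle ((Quot.out θ).1 n) ((Quot.out φ).1 n)

/-- The direction `θ` is the class of the geodesic `γ`, i.e. `ξ` is represented by the Cauchy
sequence `γ, γ, …`. -/
def IsDirOf {B : GaussianBasis d T Ω} {x : Space d T} (θ : Dir B x) (γ : NCGeod B x) : Prop :=
  ∃ s : CauchyDir B x, (∀ n, s.1 n = γ) ∧ θ = Quot.mk _ s

/-- `(θ, r) ∼ (φ, s)` iff they are equal or `r = s = 0`. -/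
def tipSetoid (B : GaussianBasis d T Ω) (x : Space d T) : Setoid (Dir B x × ℝ≥0) where
  r a b := a = b ∨ (a.2 = 0 ∧ b.2 = 0)
  iseqv :=
    { refl := fun _ => Or.inl rfl
      symm := by
        rintro a b (h | h)
        · exact Or.inl h.symm
        · exact Or.inr h.symm
      trans := by
        rintro a b c (rfl | h) (rfl | h')
        · exact Or.inl rfl
        · exact Or.inr h'
        · exact Or.inr h
        · exact Or.inr ⟨h.1, h'.2⟩ }

/-- The tangent cone `𝐓(x)`: the metric cone over the space of directions. -/
def TangentCone (B : GaussianBasis d T Ω) (x : Space d T) : Type := Quotient (tipSetoid B x)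

/-- The tangent vector with direction `θ` and length `r`. -/
def TangentCone.mk {B : GaussianBasis d T Ω} {x : Space d T} (θ : Dir B x) (r : ℝ≥0) :
    TangentCone B x := Quotient.mk (tipSetoid B x) (θ, r)

/-- The cone metric `d((θ,r),(φ,s))² = r² + s² - 2 r s cos ∠(θ, φ)`. -/
def TangentCone.dist {B : GaussianBasis d T Ω} {x : Space d T} (ξ ζ : TangentCone B x) : ℝ :=
  Quotient.lift₂ (s₁ := tipSetoid B x) (s₂ := tipSetoid B x)
    (fun a b : Dir B x × ℝ≥0 =>
      √((a.2 : ℝ) ^ 2 + (b.2 : ℝ) ^ 2 - 2 * a.2 * b.2 * Real.cos (a.1.angle b.1)))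
    (by
      rintro a b a' b' (rfl | ⟨h₁, h₂⟩) (rfl | ⟨h₃, h₄⟩)
      · rfl
      · simp [h₃, h₄]
      · simp [h₁, h₂]
      · simp [h₁, h₂, h₃, h₄]) ξ ζ

/-- The geodesic `η` has initial velocity `ξ`: writing `ξ = (θ, r)`, its length `d(x, η(1))` is `r`
and, unless `η` has zero speed, its direction is `θ`. -/
def HasInitialVelocity {B : GaussianBasis d T Ω} {x : Space d T} (η : Geod B x)
    (ξ : TangentCone B x) : Prop :=
  ∃ (θ : Dir B x) (r : ℝ≥0), ξ = TangentCone.mk θ r ∧ qdist B x (η.1 1) = r ∧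
    ∀ h : ¬ IsConst η, IsDirOf θ ⟨η, h⟩

/-- The partially defined exponential map at `x`: `ξ` is sent to the endpoint of the unique constant
speed geodesic starting at `x` with initial velocity `ξ`, and the map is undefined at `ξ` if there
is no such unique geodesic. -/
def expMap (B : GaussianBasis d T Ω) (x : Space d T) (ξ : TangentCone B x) : Part (Space d T) where
  Dom := ∃! η : Geod B x, HasInitialVelocity η ξ
  get h := h.choose.1 1

/-- `ι` is the canonical identification of `𝐓([L])` with `𝒱(L)`: if `V ∈ 𝐕(L) \ {0}` represents the
geodesic `γ`, i.e. `γ(u) = [L + u V]`, then the vector of length `r` in the direction of `γ` is sent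
to `r V / ‖V‖`. -/
def IsCanonical (B : GaussianBasis d T Ω) (L : lowerBlock d T)
    (ι : TangentCone B (toClass L) ≃ calV L) : Prop :=
  ∀ V ∈ bfV L, V ≠ 0 → ∀ γ : NCGeod B (toClass L),
    (∀ u : unitInterval, γ.1.1 u = toClass (L + (u : ℝ) • V)) →
    ∀ θ : Dir B (toClass L), IsDirOf θ γ → ∀ r : ℝ≥0,
      (ι (TangentCone.mk θ r) : lowerBlock d T) = ((r : ℝ) / ‖V‖) • V

end ABW

end

/-! The distance is a Procrustes distance: `dABW B L M` is the minimum of `‖L - M O‖` over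
block-orthogonal `O` (`dABW_eq`). It is at most this minimum because rotating each `G_t` by an
orthogonal matrix does not change nested laws (`nestedLaw_process_rot`). Conversely, a nested law
determines the law of every `E[f(Z) | 𝓖_n]` with `n ≥ 1` (`map_condExp_eq`), hence the Gram matrices
in `L²` of the increments in `n` of the conditional expectations of the coordinates. Gelbrich's
inequality, applied to each increment separately, produces one orthogonal block per time step
(`exists_blockOrth_norm_sub_le`).

Thus `𝐋/𝐎` is the quotient of a Euclidean space by a compact group of isometries. Its geodesics from
`[L]` are the images of segments `L + u V` with `V ∈ 𝐕(L)` (`exists_segment`), and first-order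
optimality makes such `V` horizontal, i.e. `V ∈ 𝒱(L)` (`bfV_subset_calV`).

Regularity bounds `‖L (1 - O)‖` below by a multiple of `‖1 - O‖` (`exists_mul_norm_le`), whereas a
horizontal vector is orthogonal to `L (1 - O)` up to an error of order `‖1 - O‖²`
(`exists_abs_inner_le`). For short vectors the quadratic gain beats this error. Hence small
multiples of every horizontal vector lie in `𝐕(L)` (`exists_smul_mem_bfV`), and the squared distance
of `[L + u V]` and `[L + u W]` is `u² ‖V - W‖²` up to `O(u⁴)` (`exists_le_qdist_sq`).

Angles are therefore Frobenius angles of lifts (`angle_eq`). Every unit vector of `𝒱(L)` is the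
direction of an actual geodesic (`exists_dir_eq`), so the completion adds nothing, and the cone over
the unit sphere of `𝒱(L)` is `𝒱(L)`. The same fact forces uniqueness of `ι`, and since a direction
and a length determine the lift, geodesics with given initial velocity are unique. -/

noncomputable section

namespace ABW

/-! ### The Frobenius inner product. -/

section FrobeniusInner

variable {l m n : Type*} [Fintype l] [Fintype m] [Fintype n]

lemma frobenius_norm_sq (A : Matrix m n ℝ) : ‖A‖ ^ 2 = ∑ i, ∑ j, A i j * A i j := by
  rw [Matrix.frobenius_norm_def, ← Real.sqrt_eq_rpow, Real.sq_sqrt (by positivity)]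
  simp [← sq]

/-- The Frobenius inner product. -/
instance frobeniusInner : InnerProductSpace ℝ (Matrix m n ℝ) where
  toNormedSpace := inferInstance
  inner A B := ∑ i, ∑ j, A i j * B i j
  norm_sq_eq_re_inner A := by simp [frobenius_norm_sq]
  conj_inner_symm A B := by simp [mul_comm]
  add_left A B C := by simp [add_mul, Finset.sum_add_distrib]
  smul_left A B r := by simp [Finset.mul_sum, mul_assoc]

local notation "⟪" x ", " y "⟫" => inner ℝ x y

lemma inner_def (A B : Matrix m n ℝ) : ⟪A, B⟫ = ∑ i, ∑ j, A i j * B i j := rfl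

lemma inner_transpose (A B : Matrix m n ℝ) : ⟪A.transpose, B.transpose⟫ = ⟪A, B⟫ := by
  simp only [inner_def, Matrix.transpose_apply]
  exact Finset.sum_comm

lemma inner_eq_trace (A B : Matrix m n ℝ) : ⟪A, B⟫ = (A.transpose * B).trace := by
  rw [← inner_transpose]
  simp [inner_def, Matrix.trace, Matrix.mul_apply]

lemma inner_mul_left (A : Matrix l m ℝ) (B : Matrix m n ℝ) (C : Matrix l n ℝ) :
    ⟪A * B, C⟫ = ⟪B, A.transpose * C⟫ := by
  simp [inner_eq_trace, Matrix.mul_assoc]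

lemma inner_mul_right (A : Matrix l m ℝ) (B : Matrix m n ℝ) (C : Matrix l n ℝ) :
    ⟪A * B, C⟫ = ⟪A, C * B.transpose⟫ := by
  rw [← inner_transpose, Matrix.transpose_mul, inner_mul_left, ← inner_transpose]
  simp

lemma norm_mul_of_mul_transpose_eq_one [DecidableEq m] (A : Matrix l m ℝ) {O : Matrix m m ℝ}
    (hO : O * O.transpose = 1) : ‖A * O‖ = ‖A‖ := by
  have : ‖A * O‖ ^ 2 = ‖A‖ ^ 2 := by
    rw [← real_inner_self_eq_norm_sq, ← real_inner_self_eq_norm_sq, inner_mul_right,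
      Matrix.mul_assoc, hO, Matrix.mul_one]
  exact (sq_eq_sq₀ (norm_nonneg _) (norm_nonneg _)).1 this

end FrobeniusInner

/-! ### Optimal orthogonal alignment and polar decomposition. -/

section Orthogonal

variable {n : Type*} [Fintype n] [DecidableEq n]

local notation "⟪" x ", " y "⟫" => inner ℝ x y

lemma orthogonal_mul_transpose {O : Matrix n n ℝ} (hO : O ∈ Matrix.orthogonalGroup n ℝ) :
    O * O.transpose = 1 := (Matrix.mem_orthogonalGroup_iff n ℝ).1 hO

lemma orthogonal_transpose_mul {O : Matrix n n ℝ} (hO : O ∈ Matrix.orthogonalGroup n ℝ) :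
    O.transpose * O = 1 := (Matrix.mem_orthogonalGroup_iff' n ℝ).1 hO

lemma orthogonal_transpose_mem {O : Matrix n n ℝ} (hO : O ∈ Matrix.orthogonalGroup n ℝ) :
    O.transpose ∈ Matrix.orthogonalGroup n ℝ := by
  rw [Matrix.mem_orthogonalGroup_iff]
  simpa using orthogonal_transpose_mul hO

lemma isCompact_orthogonalGroup :
    IsCompact (Matrix.orthogonalGroup n ℝ : Set (Matrix n n ℝ)) := by
  refine Metric.isCompact_of_isClosed_isBounded ?_ ?_
  · have : (Matrix.orthogonalGroup n ℝ : Set (Matrix n n ℝ)) =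
        (fun O : Matrix n n ℝ => O * O.transpose) ⁻¹' {1} := by
      ext O
      exact Matrix.mem_orthogonalGroup_iff n ℝ
    rw [this]
    exact isClosed_singleton.preimage (by fun_prop)
  · refine (Metric.isBounded_closedBall (x := (0 : Matrix n n ℝ))
      (r := ‖(1 : Matrix n n ℝ)‖)).subset fun O hO => ?_
    have := norm_mul_of_mul_transpose_eq_one (1 : Matrix n n ℝ) (orthogonal_mul_transpose hO)
    simp [← this]

/-- A matrix for which the identity is the best orthogonal approximation is symmetric. -/
lemma isSymm_of_forall_inner_le {S : Matrix n n ℝ}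
    (h : ∀ O ∈ Matrix.orthogonalGroup n ℝ, ⟪O, S⟫ ≤ ⟪(1 : Matrix n n ℝ), S⟫) : S.IsSymm := by
  -- `A` is skew, so `exp (t A)` is a curve of orthogonal matrices through `1`; maximality at `t =
  -- 0` gives `⟪A, S⟫ = 0`. By skewness `⟪A, Sᵀ⟫ = 0` as well, whence `⟪A, A⟫ = 0`.
  set A : Matrix n n ℝ := S - S.transpose with hA
  have hskew : A ∈ skewAdjoint (Matrix n n ℝ) := by
    rw [skewAdjoint.mem_iff, Matrix.star_eq_conjTranspose]
    simp [hA]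
  have hder : HasDerivAt (fun t : ℝ => ⟪NormedSpace.exp (t • A), S⟫) ⟪A, S⟫ 0 := by
    have h1 := (hasDerivAt_exp_smul_const (𝕂 := ℝ) A (0 : ℝ)).inner ℝ (hasDerivAt_const (0 : ℝ) S)
    rw [zero_smul, NormedSpace.exp_zero, one_mul, inner_zero_right, zero_add] at h1
    exact h1
  have hmax : IsLocalMax (fun t : ℝ => ⟪NormedSpace.exp (t • A), S⟫) 0 := by
    refine Filter.Eventually.of_forall fun t => ?_
    have := h _ (NormedSpace.exp_mem_unitary_of_mem_skewAdjoint
      (skewAdjoint.smul_mem t hskew))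
    simp only [zero_smul, NormedSpace.exp_zero]
    exact this
  have h0 : ⟪A, S⟫ = 0 := hmax.hasDerivAt_eq_zero hder
  have h1 : ⟪A, S.transpose⟫ = 0 := by
    rw [← inner_transpose]
    have : A.transpose = -A := by simp [hA]
    rw [this, Matrix.transpose_transpose, inner_neg_left, h0, neg_zero]
  have h2 : ⟪A, A⟫ = 0 := by
    conv_lhs => rw [hA]
    rw [← hA, inner_sub_right, h0, h1, sub_zero]
  have h3 : A = 0 := inner_self_eq_zero.1 h2
  exact (sub_eq_zero.1 h3).symm

/-- Symmetry is the first-order condition; positivity comes from testing with the reflections in the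
hyperplanes `v^⊥`. -/
lemma posSemidef_of_forall_inner_le {S : Matrix n n ℝ}
    (h : ∀ O ∈ Matrix.orthogonalGroup n ℝ, ⟪O, S⟫ ≤ ⟪(1 : Matrix n n ℝ), S⟫) : S.PosSemidef := by
  refine Matrix.posSemidef_iff_dotProduct_mulVec.2
    ⟨by simpa [Matrix.IsHermitian] using (isSymm_of_forall_inner_le h).eq, fun v => ?_⟩
  by_cases hv : v = 0
  · simp [hv]
  have hvv : 0 < v ⬝ᵥ v := by simpa using (Matrix.dotProduct_star_self_pos_iff (v := v)).2 hv
  -- With this `c` the matrix `1 - c v vᵀ` is the reflection in `v^⊥`. Comparing it with `1` leaves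
  -- `0 ≤ c ⟪v vᵀ, S⟫ = c (v ⬝ᵥ S v)`.
  set c : ℝ := 2 / (v ⬝ᵥ v) with hc
  have hO : (1 - c • Matrix.vecMulVec v v : Matrix n n ℝ) ∈ Matrix.orthogonalGroup n ℝ := by
    rw [Matrix.mem_orthogonalGroup_iff]
    have hT : (1 - c • Matrix.vecMulVec v v : Matrix n n ℝ).transpose =
        1 - c • Matrix.vecMulVec v v := by
      simp [Matrix.transpose_sub, Matrix.transpose_vecMulVec]
    rw [hT]
    have hm : Matrix.vecMulVec v v * Matrix.vecMulVec v v = (v ⬝ᵥ v) • Matrix.vecMulVec v v := by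
      simp [Matrix.vecMulVec_mul_vecMulVec]
    have hcc : c * c * (v ⬝ᵥ v) = c + c := by rw [hc]; field_simp; norm_num
    simp only [mul_sub, sub_mul, one_mul, mul_one, smul_mul_assoc, mul_smul_comm, hm, smul_smul]
    rw [smul_sub, smul_smul, ← mul_assoc, hcc, add_smul]
    abel
  have h1 := h _ hO
  rw [inner_sub_left, inner_smul_left] at h1
  have h2 : ⟪Matrix.vecMulVec v v, S⟫ = v ⬝ᵥ (S.mulVec v) := by
    simp only [inner_def, Matrix.vecMulVec_apply, dotProduct, Matrix.mulVec, Finset.mul_sum]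
    exact Finset.sum_congr rfl fun i _ => Finset.sum_congr rfl fun j _ => by ring
  have hcpos : 0 < c := by positivity
  have h3 : 0 ≤ c * ⟪Matrix.vecMulVec v v, S⟫ := by
    have : (starRingEnd ℝ) c = c := rfl
    rw [this] at h1
    linarith
  rw [h2] at h3
  simpa using nonneg_of_mul_nonneg_right h3 hcpos

-- Writing `S = Rᵀ R`, this is Cauchy–Schwarz for `R O` and `R`, which have the same norm.
open scoped MatrixOrder in
lemma inner_le_of_posSemidef {S : Matrix n n ℝ} (hS : S.PosSemidef) {O : Matrix n n ℝ}
    (hO : O ∈ Matrix.orthogonalGroup n ℝ) : ⟪O, S⟫ ≤ ⟪(1 : Matrix n n ℝ), S⟫ := by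
  obtain ⟨R, rfl⟩ := CStarAlgebra.nonneg_iff_eq_star_mul_self.mp hS.nonneg
  have hR : star R = R.transpose := by simp [Matrix.star_eq_conjTranspose]
  rw [hR, ← inner_mul_left, ← inner_mul_left, Matrix.mul_one, real_inner_self_eq_norm_sq, sq]
  exact (real_inner_le_norm _ _).trans_eq
    (by rw [norm_mul_of_mul_transpose_eq_one R (orthogonal_mul_transpose hO)])

/-- Polar decomposition. -/
lemma exists_mul_posSemidef (N : Matrix n n ℝ) :
    ∃ P ∈ Matrix.orthogonalGroup n ℝ, (N * P).PosSemidef := by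
  -- At a maximiser `P` of `⟪Nᵀ, O⟫` the identity is the best orthogonal approximation of `N P`.
  obtain ⟨P, hP, hmax⟩ := isCompact_orthogonalGroup.exists_isMaxOn
    ⟨1, one_mem (Matrix.orthogonalGroup n ℝ)⟩
    (f := fun O : Matrix n n ℝ => ⟪N.transpose, O⟫) (by fun_prop)
  refine ⟨P, hP, posSemidef_of_forall_inner_le fun O hO => ?_⟩
  have h1 : ⟪N.transpose, P * O.transpose⟫ ≤ ⟪N.transpose, P⟫ :=
    hmax (mul_mem hP (orthogonal_transpose_mem hO))
  have h2 (Q : Matrix n n ℝ) : ⟪Q, N * P⟫ = ⟪N.transpose, P * Q.transpose⟫ := by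
    rw [real_inner_comm, inner_mul_left, ← inner_mul_right, real_inner_comm, ← inner_transpose,
      ← inner_transpose]
  rw [h2, h2, Matrix.transpose_one, Matrix.mul_one]
  exact h1

end Orthogonal

/-! ### Block-orthogonal alignment. -/

section Blocks

variable {d T : ℕ}

local notation "⟪" x ", " y "⟫" => inner ℝ x y

lemma blockOrth_mul_transpose {O : Mat d T} (hO : O ∈ blockOrth d T) : O * O.transpose = 1 := by
  obtain ⟨P, hP, rfl⟩ := hO
  have : (blockDiag P).transpose = blockDiag fun t => (P t).transpose := by
    ext ⟨t, i⟩ ⟨s, j⟩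
    by_cases h : t = s
    · subst h; simp [blockDiag]
    · simp [blockDiag, h, Ne.symm h]
  rw [this, blockDiag_mul, ← blockDiag_one]
  exact congrArg _ (funext fun t => orthogonal_mul_transpose (hP t))

lemma blockOrth_transpose_mem {O : Mat d T} (hO : O ∈ blockOrth d T) :
    O.transpose ∈ blockOrth d T := by
  obtain ⟨B, hB, h⟩ := exists_inv_blockOrth hO
  have : O.transpose = B := by
    have h1 : O.transpose * O = 1 := mul_eq_one_comm.1 (blockOrth_mul_transpose hO)
    calc O.transpose = O.transpose * (O * B) := by rw [h, Matrix.mul_one]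
      _ = B := by rw [← Matrix.mul_assoc, h1, Matrix.one_mul]
  rwa [this]

lemma blockOrth_transpose_mul {O : Mat d T} (hO : O ∈ blockOrth d T) : O.transpose * O = 1 :=
  mul_eq_one_comm.1 (blockOrth_mul_transpose hO)

lemma norm_mul_blockOrth (A : Mat d T) {O : Mat d T} (hO : O ∈ blockOrth d T) : ‖A * O‖ = ‖A‖ :=
  norm_mul_of_mul_transpose_eq_one A (blockOrth_mul_transpose hO)

lemma inner_blockDiag (A : Mat d T) (O : Fin T → Matrix (Fin d) (Fin d) ℝ) :
    ⟪blockDiag O, A⟫ = ∑ t, ⟪O t, diagBlock A t⟫ := by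
  simp only [inner_def, Fintype.sum_prod_type, blockDiag, diagBlock, Matrix.of_apply]
  refine Finset.sum_congr rfl fun t _ => Finset.sum_congr rfl fun i _ => ?_
  rw [Finset.sum_eq_single t]
  · simp
  · intro s _ hs
    simp [Ne.symm hs]
  · simp

lemma mul_blockOrth_mem (L : lowerBlock d T) {O : Mat d T} (hO : O ∈ blockOrth d T) :
    (L : Mat d T) * O ∈ lowerBlock d T := by
  obtain ⟨P, hP, rfl⟩ := hO
  intro p q hpq
  rw [Matrix.mul_apply]
  refine Finset.sum_eq_zero fun r _ => ?_
  by_cases h : r.1 = q.1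
  · rw [L.2 p r (h ▸ hpq), zero_mul]
  · simp [blockDiag, h]

/-- Right multiplication by a block-orthogonal matrix. -/
def rot (L : lowerBlock d T) (O : blockOrth d T) : lowerBlock d T :=
  ⟨(L : Mat d T) * (O : Mat d T), mul_blockOrth_mem L O.2⟩

lemma toClass_eq_iff {L M : lowerBlock d T} :
    toClass L = toClass M ↔ ∃ O ∈ blockOrth d T, (L : Mat d T) = (M : Mat d T) * O :=
  Quotient.eq (r := orthSetoid d T)

lemma toClass_rot (L : lowerBlock d T) (O : blockOrth d T) : toClass (rot L O) = toClass L :=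
  toClass_eq_iff.2 ⟨O, O.2, rfl⟩

lemma norm_sub_sq_eq (L N : Mat d T) : ‖L - N‖ ^ 2 = ‖L‖ ^ 2 + ‖N‖ ^ 2 - 2 * ⟪L, N⟫ := by
  rw [norm_sub_sq_real]; ring

lemma inner_mul_eq (L M Q : Mat d T) : ⟪L, M * Q⟫ = ⟪Q.transpose, L.transpose * M⟫ := by
  rw [← inner_mul_left, real_inner_comm, inner_mul_right, real_inner_comm]

/-- If all the diagonal blocks of `Lᵀ M` are positive semidefinite, then the identity is the best
block-orthogonal alignment of `M` to `L`. -/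
lemma norm_sub_le_of_posSemidef {L M : Mat d T}
    (h : ∀ t, (diagBlock (L.transpose * M) t).PosSemidef) {O : Mat d T} (hO : O ∈ blockOrth d T) :
    ‖L - M‖ ≤ ‖L - M * O‖ := by
  refine (sq_le_sq₀ (norm_nonneg _) (norm_nonneg _)).1 ?_
  rw [norm_sub_sq_eq, norm_sub_sq_eq, norm_mul_blockOrth _ hO]
  suffices ⟪L, M * O⟫ ≤ ⟪L, M⟫ by linarith
  have h3 := inner_mul_eq L M 1
  rw [Matrix.mul_one, Matrix.transpose_one] at h3
  rw [inner_mul_eq, h3]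
  obtain ⟨P, hP, hPO⟩ := blockOrth_transpose_mem hO
  rw [hPO, inner_blockDiag, ← blockDiag_one, inner_blockDiag]
  exact Finset.sum_le_sum fun t _ => inner_le_of_posSemidef (h t) (hP t)

/-- If the identity is the best block-orthogonal alignment of `M` to `L`, then the diagonal blocks
of `Lᵀ M` are symmetric. -/
lemma isSymm_of_norm_sub_le {L M : Mat d T}
    (h : ∀ O ∈ blockOrth d T, ‖L - M‖ ≤ ‖L - M * O‖) (t : Fin T) :
    (diagBlock (L.transpose * M) t).IsSymm := by
  refine isSymm_of_forall_inner_le fun O hO => ?_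
  -- Only block `t` is rotated, so the contributions of the other blocks cancel in the comparison.
  set P : Fin T → Matrix (Fin d) (Fin d) ℝ := Function.update (fun _ => 1) t O with hP
  have hPm : blockDiag P ∈ blockOrth d T := by
    refine ⟨P, fun s => ?_, rfl⟩
    by_cases hs : s = t
    · subst hs; simpa [hP] using hO
    · simp only [hP, Function.update_of_ne hs]; exact one_mem _
  have h1 := (sq_le_sq₀ (norm_nonneg _) (norm_nonneg _)).2 (h _ (blockOrth_transpose_mem hPm))
  rw [norm_sub_sq_eq, norm_sub_sq_eq, norm_mul_blockOrth _ (blockOrth_transpose_mem hPm)] at h1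
  have h3 := inner_mul_eq L M 1
  rw [Matrix.mul_one, Matrix.transpose_one, ← blockDiag_one, inner_blockDiag] at h3
  rw [inner_mul_eq, Matrix.transpose_transpose, inner_blockDiag, h3,
    Fintype.sum_eq_add_sum_compl t, Fintype.sum_eq_add_sum_compl t] at h1
  have h4 : ∑ s ∈ {t}ᶜ, ⟪P s, diagBlock (L.transpose * M) s⟫ =
      ∑ s ∈ {t}ᶜ, ⟪(1 : Matrix (Fin d) (Fin d) ℝ), diagBlock (L.transpose * M) s⟫ := by
    refine Finset.sum_congr rfl fun s hs => ?_
    rw [hP, Function.update_of_ne (by simpa using hs)]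
  rw [h4, show P t = O by simp [hP]] at h1
  linarith

lemma exists_norm_sub_le (L M : Mat d T) :
    ∃ P ∈ blockOrth d T, ∀ O ∈ blockOrth d T, ‖L - M * P‖ ≤ ‖L - M * P * O‖ := by
  choose P hP hS using fun t => exists_mul_posSemidef (diagBlock (L.transpose * M) t)
  refine ⟨blockDiag P, ⟨P, hP, rfl⟩, fun O hO => norm_sub_le_of_posSemidef (fun t => ?_) hO⟩
  convert hS t using 1
  ext i j
  rw [← Matrix.mul_assoc]
  simp only [diagBlock, Matrix.of_apply, Matrix.mul_apply (M := L.transpose * M), blockDiag,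
    Fintype.sum_prod_type, Matrix.mul_apply (N := P t)]
  rw [Finset.sum_eq_single t]
  · simp
  · intro s _ hs
    simp [hs]
  · simp

end Blocks

/-! ### Gelbrich's inequality for families of vectors. -/

section Gelbrich

open scoped Matrix

variable {H : Type*} [NormedAddCommGroup H] [InnerProductSpace ℝ H]

local notation "⟪" x ", " y "⟫" => inner ℝ x y

/-- Equality of norms makes `a` factor isometrically through the range of `f`. Precomposing with the
orthogonal projection onto that range extends the factor to all of `W`, at the price of being only a
contraction. -/
lemma exists_contraction_comp_eq {U W : Type*} [AddCommGroup U] [Module ℝ U]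
    [NormedAddCommGroup W] [InnerProductSpace ℝ W] [FiniteDimensional ℝ W]
    (a : U →ₗ[ℝ] H) (f : U →ₗ[ℝ] W) (h : ∀ u, ‖a u‖ = ‖f u‖) :
    ∃ g : W →ₗ[ℝ] H, (∀ w, ‖g w‖ ≤ ‖w‖) ∧ ∀ u, g (f u) = a u := by
  obtain ⟨σ, hσ⟩ := f.rangeRestrict.exists_rightInverse_of_surjective
    (LinearMap.range_eq_top.2 f.surjective_rangeRestrict)
  have hσ' (w : LinearMap.range f) : f (σ w) = w := by
    have := LinearMap.congr_fun hσ w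
    exact congrArg Subtype.val this
  refine ⟨a ∘ₗ σ ∘ₗ (LinearMap.range f).orthogonalProjectionOnto.toLinearMap, fun w => ?_, fun u => ?_⟩
  · simp only [LinearMap.comp_apply, h, hσ']
    exact (LinearMap.range f).norm_starProjection_apply_le w
  · have hu : (LinearMap.range f).orthogonalProjectionOnto (f u) = ⟨f u, LinearMap.mem_range_self f u⟩ :=
      Submodule.orthogonalProjectionOnto_mem_subspace_eq_self (⟨f u, LinearMap.mem_range_self f u⟩ :
        LinearMap.range f)
    -- The section `σ` returns `u` only modulo the kernel of `f`, on which `a` vanishes.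
    have h0 : ‖a (σ ⟨f u, LinearMap.mem_range_self f u⟩ - u)‖ = 0 := by
      rw [h, map_sub, hσ', sub_self, norm_zero]
    rw [norm_eq_zero, map_sub, sub_eq_zero] at h0
    simpa [hu] using h0

variable {ι κ : Type*} [Fintype ι] [Fintype κ]

/-- A substitute for writing `a = A ξ` with `ξ` orthonormal, which fails if `H` has too small a
dimension. The contraction bound on `ξ` is all that Gelbrich's inequality needs. -/
lemma exists_factorization (A : Matrix ι κ ℝ) (a : ι → H)
    (h : ∀ u : ι → ℝ, ‖∑ p, u p • a p‖ ^ 2 = (u ᵥ* A) ⬝ᵥ (u ᵥ* A)) :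
    ∃ ξ : κ → H, (∀ c : κ → ℝ, ‖∑ j, c j • ξ j‖ ^ 2 ≤ c ⬝ᵥ c) ∧
      ∀ p, a p = ∑ j, A p j • ξ j := by
  classical
  have hnorm (c : κ → ℝ) : ‖WithLp.toLp 2 c‖ ^ 2 = c ⬝ᵥ c := by
    rw [EuclideanSpace.real_norm_sq_eq]; simp [dotProduct, sq]
  obtain ⟨g, hg, hga⟩ := exists_contraction_comp_eq (Fintype.linearCombination ℝ a)
    ((WithLp.linearEquiv 2 ℝ (κ → ℝ)).symm.toLinearMap ∘ₗ A.vecMulLinear) (fun u => by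
      refine (sq_eq_sq₀ (norm_nonneg _) (norm_nonneg _)).1 ?_
      rw [Fintype.linearCombination_apply, h, ← hnorm]
      rfl)
  have hg' (c : κ → ℝ) : ∑ j, c j • g (EuclideanSpace.single j 1) = g (WithLp.toLp 2 c) := by
    simp only [← map_smul, ← map_sum]
    congr 1
    ext j
    simp [Finset.sum_apply, Pi.single_apply]
  refine ⟨fun j => g (EuclideanSpace.single j 1), fun c => ?_, fun p => ?_⟩
  · rw [hg', ← hnorm]
    exact pow_le_pow_left₀ (norm_nonneg _) (hg _) 2
  · rw [hg' (A p)]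
    have := hga (Pi.single p 1)
    simpa [Matrix.row] using this.symm

lemma sum_inner_linearCombination {ι : Type*} [Fintype ι] (C D : Matrix ι κ ℝ) (ξ ζ : κ → H) :
    ∑ p, ⟪∑ i, C p i • ξ i, ∑ j, D p j • ζ j⟫ = ∑ i, ∑ j, (C.transpose * D) i j * ⟪ξ i, ζ j⟫ := by
  have h (p : ι) : ⟪∑ i, C p i • ξ i, ∑ j, D p j • ζ j⟫ =
      ∑ i, ∑ j, C p i * D p j * ⟪ξ i, ζ j⟫ := by
    rw [sum_inner]
    refine Finset.sum_congr rfl fun i _ => ?_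
    rw [real_inner_smul_left, inner_sum, Finset.mul_sum]
    exact Finset.sum_congr rfl fun j _ => by rw [real_inner_smul_right, mul_assoc]
  simp only [h, Matrix.mul_apply, Matrix.transpose_apply, Finset.sum_mul]
  rw [Finset.sum_comm]
  exact Finset.sum_congr rfl fun i _ => Finset.sum_comm

/-- Gelbrich's inequality: two families of vectors with Gram matrices `A Aᵀ` and `B Bᵀ` are at
least as far apart as `A` and `B`, up to an orthogonal matrix. -/
lemma exists_norm_sub_mul_le [DecidableEq κ] (A B : Matrix ι κ ℝ) (a b : ι → H)
    (ha : ∀ u : ι → ℝ, ‖∑ p, u p • a p‖ ^ 2 = (u ᵥ* A) ⬝ᵥ (u ᵥ* A))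
    (hb : ∀ u : ι → ℝ, ‖∑ p, u p • b p‖ ^ 2 = (u ᵥ* B) ⬝ᵥ (u ᵥ* B)) :
    ∃ O ∈ Matrix.orthogonalGroup κ ℝ, ‖A - B * O‖ ^ 2 ≤ ∑ p, ‖a p - b p‖ ^ 2 := by
  classical
  obtain ⟨O, hO, hS⟩ := exists_mul_posSemidef (A.transpose * B)
  refine ⟨O, hO, ?_⟩
  rw [Matrix.mul_assoc] at hS
  have hb' : ∀ u : ι → ℝ, ‖∑ p, u p • b p‖ ^ 2 = (u ᵥ* (B * O)) ⬝ᵥ (u ᵥ* (B * O)) := by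
    intro u
    rw [hb, ← Matrix.vecMul_vecMul]
    generalize u ᵥ* B = w
    rw [← Matrix.dotProduct_mulVec, ← Matrix.mulVec_transpose O, Matrix.mulVec_mulVec,
      orthogonal_mul_transpose hO, Matrix.one_mulVec]
  obtain ⟨ξ, hξ, haξ⟩ := exists_factorization A a ha
  obtain ⟨ζ, hζ, hbζ⟩ := exists_factorization (B * O) b hb'
  generalize B * O = B' at *
  obtain ⟨R, hR⟩ : ∃ R : Matrix κ κ ℝ, A.transpose * B' = R.transpose * R := by
    open scoped MatrixOrder in
    obtain ⟨R, hR⟩ := CStarAlgebra.nonneg_iff_eq_star_mul_self.mp hS.nonneg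
    exact ⟨R, by simpa [Matrix.star_eq_conjTranspose] using hR⟩
  have hgram (A : Matrix ι κ ℝ) (a : ι → H)
      (h : ∀ u : ι → ℝ, ‖∑ p, u p • a p‖ ^ 2 = (u ᵥ* A) ⬝ᵥ (u ᵥ* A)) :
      ∑ p, ‖a p‖ ^ 2 = ‖A‖ ^ 2 := by
    rw [frobenius_norm_sq]
    refine Finset.sum_congr rfl fun p _ => ?_
    simpa [dotProduct, Pi.single_apply] using h (Pi.single p 1)
  -- The choice of `O` makes `Aᵀ B' = Rᵀ R`, so the left side is a sum over rows `R k` of inner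
  -- products of two vectors of norm at most `|R k|`, while the right side is the sum of `|R k|²`.
  have hcross : ∑ p, ⟪a p, b p⟫ ≤ ⟪A, B'⟫ := by
    have h1 : ∑ p, ⟪a p, b p⟫ = ∑ k, ⟪∑ i, R k i • ξ i, ∑ j, R k j • ζ j⟫ := by
      simp only [haξ, hbζ]
      rw [sum_inner_linearCombination A B', hR, ← sum_inner_linearCombination R R]
    have h5 : ⟪A, B'⟫ = ∑ k, R k ⬝ᵥ R k := by
      rw [inner_eq_trace, hR, ← inner_eq_trace]; rfl
    rw [h1, h5]
    refine Finset.sum_le_sum fun k _ => (real_inner_le_norm _ _).trans ?_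
    have h6 := hξ (R k)
    have h7 := hζ (R k)
    nlinarith [sq_nonneg (‖∑ i, R k i • ξ i‖ - ‖∑ j, R k j • ζ j‖)]
  have hsum : ∑ p, ‖a p - b p‖ ^ 2 = ∑ p, ‖a p‖ ^ 2 - 2 * ∑ p, ⟪a p, b p⟫ + ∑ p, ‖b p‖ ^ 2 := by
    simp only [norm_sub_sq_real, Finset.sum_add_distrib, Finset.sum_sub_distrib, Finset.mul_sum]
  rw [hsum, hgram A a ha, hgram B' b hb', norm_sub_sq_real]
  linarith

end Gelbrich

/-! ### Gelbrich's inequality along an increasing family of subspaces. -/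

section Filtration

open scoped Matrix

variable {H : Type*} [NormedAddCommGroup H] [InnerProductSpace ℝ H]
  (K : ℕ → Submodule ℝ H) [∀ n, (K n).HasOrthogonalProjection]

lemma norm_sq_starProjection_sub (hK : Monotone K) (n : ℕ) (x : H) :
    ‖(K (n + 1)).starProjection x - (K n).starProjection x‖ ^ 2 =
      ‖(K (n + 1)).starProjection x‖ ^ 2 - ‖(K n).starProjection x‖ ^ 2 := by
  set y := (K (n + 1)).starProjection x with hy
  have h1 : (K n).starProjection x = (K n).starProjection y := by
    have := Submodule.starProjection_comp_starProjection_of_le (hK n.le_succ)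
    exact (congrArg (fun f => f x) this).symm
  have h2 := Submodule.norm_sq_eq_add_norm_sq_starProjection y (K n)
  rw [Submodule.starProjection_orthogonal_val] at h2
  rw [h1]
  linarith

lemma sum_norm_sq_starProjection_sub (hK : Monotone K) (h0 : K 0 = ⊥) (T : ℕ) {x : H}
    (hx : x ∈ K T) :
    ∑ n : Fin T, ‖(K (n + 1)).starProjection x - (K n).starProjection x‖ ^ 2 = ‖x‖ ^ 2 := by
  simp only [norm_sq_starProjection_sub K hK]
  rw [Fin.sum_univ_eq_sum_range
    (fun n => ‖(K (n + 1)).starProjection x‖ ^ 2 - ‖(K n).starProjection x‖ ^ 2),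
    Finset.sum_range_sub (fun n => ‖(K n).starProjection x‖ ^ 2)]
  have hx' : (K T).starProjection x = x := Submodule.starProjection_eq_self_iff.2 hx
  have hx0 : (K 0).starProjection x = 0 := by
    have : (K 0).starProjection x ∈ K 0 := (K 0).starProjection_apply_mem x
    exact (Submodule.mem_bot ℝ).1 (h0.le this)
  rw [hx', hx0]; simp

/-- The columns of a block matrix that belong to a given block. -/
def blockCol {d T : ℕ} (A : Mat d T) (t : Fin T) : Matrix (Fin T × Fin d) (Fin d) ℝ :=
  Matrix.of fun p j => A p (t, j)

lemma norm_sq_eq_sum_blockCol {d T : ℕ} (A : Mat d T) : ‖A‖ ^ 2 = ∑ t, ‖blockCol A t‖ ^ 2 := by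
  simp only [frobenius_norm_sq, blockCol, Matrix.of_apply]
  rw [Finset.sum_comm (s := (Finset.univ : Finset (Fin T)))]
  exact Finset.sum_congr rfl fun p _ => Fintype.sum_prod_type _

lemma blockCol_sub_mul {d T : ℕ} (L M : Mat d T) (O : Fin T → Matrix (Fin d) (Fin d) ℝ)
    (t : Fin T) : blockCol (L - M * blockDiag O) t = blockCol L t - blockCol M t * O t := by
  ext p j
  simp only [blockCol, Matrix.of_apply, Matrix.sub_apply, Matrix.mul_apply, blockDiag,
    Fintype.sum_prod_type]
  rw [Finset.sum_eq_single t]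
  · simp
  · intro s _ hs; simp [hs]
  · simp

/-- The filtered version of Gelbrich's inequality. -/
lemma exists_blockOrth_norm_sub_le (hK : Monotone K) (h0 : K 0 = ⊥) {d T : ℕ} (L M : Mat d T)
    (x y : Fin T × Fin d → H) (hx : ∀ p, x p ∈ K T) (hy : ∀ p, y p ∈ K T)
    (hxL : ∀ n ≤ T, ∀ u : Fin T × Fin d → ℝ, ‖(K n).starProjection (∑ p, u p • x p)‖ ^ 2 =
      ∑ s : Fin T, if (s : ℕ) < n then (u ᵥ* blockCol L s) ⬝ᵥ (u ᵥ* blockCol L s) else 0)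
    (hyM : ∀ n ≤ T, ∀ u : Fin T × Fin d → ℝ, ‖(K n).starProjection (∑ p, u p • y p)‖ ^ 2 =
      ∑ s : Fin T, if (s : ℕ) < n then (u ᵥ* blockCol M s) ⬝ᵥ (u ᵥ* blockCol M s) else 0) :
    ∃ O ∈ blockOrth d T, ‖L - M * O‖ ^ 2 ≤ ∑ p, ‖x p - y p‖ ^ 2 := by
  -- `D n` projects onto the part of `K (n + 1)` orthogonal to `K n`; the hypotheses say that the
  -- `n`-th increments of the two families have the Gram matrices of the `n`-th block columns.
  set D : Fin T → H →ₗ[ℝ] H := fun n =>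
    ((K (n + 1)).starProjection - (K n).starProjection).toLinearMap with hD
  have key (L : Mat d T) (x : Fin T × Fin d → H)
      (hxL : ∀ n ≤ T, ∀ u : Fin T × Fin d → ℝ, ‖(K n).starProjection (∑ p, u p • x p)‖ ^ 2 =
        ∑ s : Fin T, if (s : ℕ) < n then (u ᵥ* blockCol L s) ⬝ᵥ (u ᵥ* blockCol L s) else 0)
      (n : Fin T) (u : Fin T × Fin d → ℝ) :
      ‖∑ p, u p • D n (x p)‖ ^ 2 = (u ᵥ* blockCol L n) ⬝ᵥ (u ᵥ* blockCol L n) := by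
    have h1 : ∑ p, u p • D n (x p) = D n (∑ p, u p • x p) := by
      simp only [map_sum, map_smul]
    have h2 := norm_sq_starProjection_sub K hK n (∑ p, u p • x p)
    rw [hxL _ n.2, hxL _ n.2.le, ← Finset.sum_sub_distrib, Finset.sum_eq_single n] at h2
    · rw [h1, hD]
      simp only [Nat.lt_succ_self, if_true, lt_irrefl, if_false, sub_zero] at h2
      exact h2
    · intro s _ hs
      have : (s : ℕ) ≠ n := fun h => hs (Fin.ext h)
      by_cases h : (s : ℕ) < n
      · simp [h, Nat.lt_succ_of_lt h]
      · have h' : ¬ (s : ℕ) < n + 1 := by omega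
        simp [h, h']
    · simp
  choose O hO hle using fun n => exists_norm_sub_mul_le (blockCol L n) (blockCol M n)
    (fun p => D n (x p)) (fun p => D n (y p)) (key L x hxL n) (key M y hyM n)
  refine ⟨blockDiag O, ⟨O, hO, rfl⟩, ?_⟩
  rw [norm_sq_eq_sum_blockCol]
  simp only [blockCol_sub_mul]
  refine (Finset.sum_le_sum fun n _ => hle n).trans_eq ?_
  rw [Finset.sum_comm]
  refine Finset.sum_congr rfl fun p _ => ?_
  rw [← sum_norm_sq_starProjection_sub K hK h0 T (sub_mem (hx p) (hy p))]
  refine Finset.sum_congr rfl fun n _ => ?_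
  rw [← map_sub]
  rfl

end Filtration

/-! ### What the nested law determines. -/

section NestedLaw

variable {d T : ℕ} {Ω : Type*} [MeasurableSpace Ω] (B : GaussianBasis d T Ω)

lemma filt_le (n : ℕ) : B.filt n ≤ ‹MeasurableSpace Ω› :=
  iSup₂_le fun s _ => (B.measurable_G s).comap_le

lemma filt_mono : Monotone B.filt := fun _ _ hmn =>
  iSup_mono fun _ => iSup_mono' fun hs => ⟨hs.trans_le hmn, le_rfl⟩

variable [StandardBorelSpace Ω]

lemma measurable_condNest {Z : Ω → Path d T} (hZ : Measurable Z) :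
    ∀ k, Measurable (B.condNest Z k)
  | 0 => hZ
  | k + 1 => (Measure.measurable_map _ (measurable_condNest hZ k)).comp
      ((condExpKernel B.P (B.filt (T - 1 - k))).measurable.mono (filt_le B _) le_rfl)

/-- The iterated barycentre of a function on the path space. -/
def bary (f : Path d T → ℝ) : (k : ℕ) → (nestedSpace d T k).1 → ℝ
  | 0 => f
  | k + 1 => fun μ : Measure (nestedSpace d T k).1 =>
      -- Lower integrals of the positive and negative parts are defined for all measures and depend
      -- measurably on them; for integrable functions the difference is the Bochner integral.
      (∫⁻ x, ENNReal.ofReal (bary f k x) ∂μ).toReal -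
        (∫⁻ x, ENNReal.ofReal (-bary f k x) ∂μ).toReal

lemma measurable_bary {f : Path d T → ℝ} (hf : Measurable f) : ∀ k, Measurable (bary f k)
  | 0 => hf
  | k + 1 =>
    ((Measure.measurable_lintegral (measurable_bary hf k).ennreal_ofReal).ennreal_toReal).sub
      (Measure.measurable_lintegral (measurable_bary hf k).neg.ennreal_ofReal).ennreal_toReal

/-- Integration against the conditional law is conditional expectation, so each level of nesting is
one application of the tower property. -/
lemma bary_condNest {f : Path d T → ℝ} (hf : Measurable f) {Z : Ω → Path d T}
    (hZ : Measurable[B.filt T] Z) (hint : Integrable (fun ω => f (Z ω)) B.P) (k : ℕ) :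
    (fun ω => bary f k (B.condNest Z k ω)) =ᵐ[B.P] B.P[fun ω => f (Z ω) | B.filt (T - k)] := by
  have hZ' : Measurable Z := hZ.mono (filt_le B T) le_rfl
  induction k with
  | zero =>
    rw [Nat.sub_zero, condExp_of_stronglyMeasurable (filt_le B T)
      (f := fun ω => f (Z ω)) (hf.comp hZ).stronglyMeasurable hint]
    rfl
  | succ k ih =>
    have hint' : Integrable (fun ω => bary f k (B.condNest Z k ω)) B.P :=
      integrable_condExp.congr ih.symm
    have hle : T - (k + 1) ≤ T - k := by omega
    have h1 : B.P[fun ω => bary f k (B.condNest Z k ω) | B.filt (T - (k + 1))] =ᵐ[B.P]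
        B.P[fun ω => f (Z ω) | B.filt (T - (k + 1))] :=
      (condExp_congr_ae ih).trans (condExp_condExp_of_le (filt_mono B hle) (filt_le B _))
    refine EventuallyEq.trans ?_ h1
    have h2 := condExp_ae_eq_integral_condExpKernel (filt_le B (T - (k + 1))) hint'
    filter_upwards [h2, hint'.condExpKernel_ae (m := B.filt (T - (k + 1)))] with ω hω hi
    rw [hω, integral_eq_lintegral_pos_part_sub_lintegral_neg_part hi]
    have hidx : T - 1 - k = T - (k + 1) := by omega
    simp only [bary, GaussianBasis.condNest]
    rw [lintegral_map (measurable_bary hf k).ennreal_ofReal (measurable_condNest B hZ' k),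
      lintegral_map (f := fun x => ENNReal.ofReal (-bary f k x))
        (measurable_bary hf k).neg.ennreal_ofReal (measurable_condNest B hZ' k), hidx]

/-- `Measure.join` on the spaces of iterated conditional laws. -/
def nestedJoin (k : ℕ) (μ : Measure (nestedSpace d T (k + 1)).1) : Measure (nestedSpace d T k).1 :=
  Measure.join (α := (nestedSpace d T k).1) μ

/-- Averaging the conditional law recovers the law. Consequently the outermost nested law determines
the laws of all the earlier levels. -/
lemma map_condNest_eq_join {Z : Ω → Path d T} (hZ : Measurable Z) (k : ℕ) :
    B.P.map (B.condNest Z k) = nestedJoin k (B.P.map (B.condNest Z (k + 1))) := by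
  have hm := filt_le B (T - 1 - k)
  have hk := measurable_condNest B hZ k
  have hmeas : Measurable fun ω => (condExpKernel B.P (B.filt (T - 1 - k)) ω).map (B.condNest Z k) :=
    (Measure.measurable_map _ hk).comp ((condExpKernel B.P (B.filt (T - 1 - k))).measurable.mono hm le_rfl)
  change _ = Measure.join (B.P.map fun ω => (condExpKernel B.P (B.filt (T - 1 - k)) ω).map (B.condNest Z k))
  ext s hs
  rw [Measure.join_apply hs, lintegral_map (Measure.measurable_coe hs) hmeas,
    Measure.map_apply hk hs]
  have h1 := congrArg (fun μ : Measure Ω => μ (B.condNest Z k ⁻¹' s))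
    (condExpKernel_comp_trim (μ := B.P) hm)
  beta_reduce at h1
  rw [Measure.bind_apply (hk hs) ((condExpKernel B.P (B.filt (T - 1 - k))).measurable.aemeasurable),
    lintegral_trim hm (measurable_condExpKernel (hk hs))] at h1
  rw [← h1]
  exact lintegral_congr fun ω => (Measure.map_apply hk hs).symm

lemma map_condNest_eq {X Y : Ω → Path d T} (hX : Measurable X) (hY : Measurable Y)
    (h : B.nestedLaw X = B.nestedLaw Y) {k : ℕ} (hk : k ≤ T - 1) :
    B.P.map (B.condNest X k) = B.P.map (B.condNest Y k) := by
  induction hk using Nat.decreasingInduction with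
  | self => exact h
  | of_succ k hk ih => rw [map_condNest_eq_join B hX, map_condNest_eq_join B hY, ih]

/-- Processes with the same nested law have conditional expectations with the same law. -/
lemma map_condExp_eq {X Y : Ω → Path d T} (hX : Measurable[B.filt T] X)
    (hY : Measurable[B.filt T] Y) (h : B.nestedLaw X = B.nestedLaw Y) {f : Path d T → ℝ}
    (hf : Measurable f) (hfX : Integrable (fun ω => f (X ω)) B.P)
    (hfY : Integrable (fun ω => f (Y ω)) B.P) {n : ℕ} (hn : 0 < n) (hnT : n ≤ T) :
    B.P.map (B.P[fun ω => f (X ω) | B.filt n]) = B.P.map (B.P[fun ω => f (Y ω) | B.filt n]) := by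
  have hX' : Measurable X := hX.mono (filt_le B T) le_rfl
  have hY' : Measurable Y := hY.mono (filt_le B T) le_rfl
  have hn' : T - (T - n) = n := by omega
  have h1 := bary_condNest B hf hX hfX (T - n)
  have h2 := bary_condNest B hf hY hfY (T - n)
  rw [hn'] at h1 h2
  rw [← Measure.map_congr h1, ← Measure.map_congr h2]
  -- The nested law stops at level `T - 1`, i.e. at conditioning on the first vector; this is where
  -- `0 < n` enters.
  have h3 := map_condNest_eq B hX' hY' h (k := T - n) (by omega)
  have h4 := congrArg (Measure.map (bary f (T - n))) h3
  rwa [Measure.map_map (measurable_bary hf _) (measurable_condNest B hX' _),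
    Measure.map_map (measurable_bary hf _) (measurable_condNest B hY' _)] at h4

end NestedLaw

/-! ### Uniqueness of regular conditional laws. -/

section CondExpKernel

variable {Ω E : Type*} {m : MeasurableSpace Ω} [mΩ : MeasurableSpace Ω] [StandardBorelSpace Ω]
  [MeasurableSpace E] [MeasurableSpace.CountablyGenerated E]

/-- Characterisation of the regular conditional law of a random variable. -/
lemma condExpKernel_map_ae_eq (hm : m ≤ mΩ) {P : Measure Ω} [IsProbabilityMeasure P] {Y : Ω → E}
    (hY : Measurable Y) (η : @Kernel Ω E m _) [IsMarkovKernel η]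
    (h : ∀ A, MeasurableSet[m] A → ∀ S, MeasurableSet S →
      P (A ∩ Y ⁻¹' S) = ∫⁻ ω in A, η ω S ∂P) :
    ∀ᵐ ω ∂P, (condExpKernel P m ω).map Y = η ω := by
  -- Both sides are the joint law of `(id, Y)`, checked on rectangles; disintegrations are almost
  -- surely unique.
  have h1 : (P.trim hm) ⊗ₘ ((condExpKernel P m).map Y) = (P.trim hm) ⊗ₘ η := by
    refine Measure.ext_prod fun {A S} hA hS => ?_
    rw [Measure.compProd_map hY, compProd_trim_condExpKernel, Measure.compProd_apply_prod hA hS,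
      Measure.map_apply (by fun_prop) (hA.prod hS), restrict_trim hm P hA,
      lintegral_trim hm (η.measurable_coe hS), ← h A hA S hS,
      Measure.map_apply _ ((measurable_id.prodMap hY) (hA.prod hS))]
    · rfl
    · exact Measurable.prodMk (measurable_id'' hm) measurable_id
  filter_upwards [ae_of_ae_trim hm (Kernel.ae_eq_of_compProd_eq h1)] with ω hω
  rw [← hω, Kernel.map_apply _ hY]

end CondExpKernel

/-! ### Resampling the future of a Gaussian path. -/

section Splice

variable {d T : ℕ}

/-- The law of a sequence of independent standard Gaussian vectors. -/
def gaussPath (d T : ℕ) : Measure (Path d T) :=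
  Measure.pi fun _ => stdGaussian (EuclideanSpace ℝ (Fin d))

instance : IsProbabilityMeasure (gaussPath d T) := by unfold gaussPath; infer_instance

/-- The path which agrees with `g` before time `n` and with `x` from time `n` on. -/
def splice (n : ℕ) (g x : Path d T) : Path d T := fun t => if (t : ℕ) < n then g t else x t

lemma measurable_splice (n : ℕ) : Measurable fun p : Path d T × Path d T => splice n p.1 p.2 := by
  refine measurable_pi_iff.2 fun t => ?_
  by_cases h : (t : ℕ) < n
  · simp only [splice, h, if_true]; fun_prop
  · simp only [splice, h, if_false]; fun_prop

lemma measurable_splice_right (n : ℕ) (g : Path d T) : Measurable (splice n g) :=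
  (measurable_splice n).comp (measurable_prodMk_left (x := g))

lemma measurable_splice_left (n : ℕ) (x : Path d T) : Measurable fun g => splice n g x :=
  (measurable_splice n).comp (measurable_prodMk_right (y := x))

/-- Independence of past and future in the form used below: the future may be replaced by that of an
independent copy. -/
lemma map_splice_gaussPath (n : ℕ) :
    ((gaussPath d T).prod (gaussPath d T)).map (fun p => splice n p.1 p.2) = gaussPath d T := by
  refine (Measure.pi_eq fun s hs => ?_).symm
  have hpre : (fun p : Path d T × Path d T => splice n p.1 p.2) ⁻¹' (Set.univ.pi s) =
      (Set.univ.pi fun t : Fin T => if (t : ℕ) < n then s t else Set.univ) ×ˢ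
        (Set.univ.pi fun t : Fin T => if (t : ℕ) < n then Set.univ else s t) := by
    ext p
    simp only [Set.mem_preimage, Set.mem_pi, Set.mem_univ, true_imp_iff, Set.mem_prod, splice,
      ← forall_and]
    refine forall_congr' fun t => ?_
    by_cases h : (t : ℕ) < n <;> simp [h]
  rw [Measure.map_apply (measurable_splice n) (MeasurableSet.univ_pi hs), hpre, Measure.prod_prod,
    gaussPath, Measure.pi_pi, Measure.pi_pi, ← Finset.prod_mul_distrib]
  refine Finset.prod_congr rfl fun t _ => ?_
  by_cases h : (t : ℕ) < n <;> simp [h]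

lemma measurable_map_splice (n : ℕ) :
    Measurable fun g : Path d T => (gaussPath d T).map (splice n g) := by
  have h : Measurable fun g : Path d T => ((gaussPath d T).map (Prod.mk g)).map
      (fun p : Path d T × Path d T => splice n p.1 p.2) :=
    (Measure.measurable_map _ (measurable_splice n)).comp Measurable.map_prodMk_left
  convert h using 2 with g
  rw [Measure.map_map (measurable_splice n) measurable_prodMk_left]
  rfl

lemma splice_splice_left (n : ℕ) (g x y : Path d T) :
    splice n (splice n g x) y = splice n g y := by
  ext t
  by_cases h : (t : ℕ) < n <;> simp [splice, h]

/-- The iterated conditional laws of `F`, as functions of the Gaussian path. -/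
def nestedFn (F : Path d T → Path d T) : (k : ℕ) → Path d T → (nestedSpace d T k).1
  | 0 => F
  | k + 1 => fun g =>
      (((gaussPath d T).map (splice (T - 1 - k) g)).map (nestedFn F k) :
        Measure (nestedSpace d T k).1)

lemma measurable_nestedFn {F : Path d T → Path d T} (hF : Measurable F) :
    ∀ k, Measurable (nestedFn F k)
  | 0 => hF
  | k + 1 => (Measure.measurable_map _ (measurable_nestedFn hF k)).comp (measurable_map_splice _)

end Splice

/-! ### Moments of linear functionals of Gaussian paths. -/

section Moments

variable {d T : ℕ}

lemma memLp_inner_gaussPath (c : Fin T → EuclideanSpace ℝ (Fin d)) (t : Fin T) :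
    MemLp (fun g : Path d T => inner ℝ (c t) (g t)) 2 (gaussPath d T) := by
  have h : MemLp (fun x => inner ℝ (c t) x) 2 (stdGaussian (EuclideanSpace ℝ (Fin d))) :=
    (IsGaussian.memLp_two_id (μ := stdGaussian (EuclideanSpace ℝ (Fin d)))).const_inner (c t)
  exact h.comp_measurePreserving (measurePreserving_eval _ t)

lemma integral_inner_gaussPath (c : Fin T → EuclideanSpace ℝ (Fin d)) (t : Fin T) :
    ∫ g : Path d T, inner ℝ (c t) (g t) ∂(gaussPath d T) = 0 := by
  have h := integral_strongDual_stdGaussian (innerSL ℝ (c t))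
  have h1 := (measurePreserving_eval (fun _ : Fin T => stdGaussian (EuclideanSpace ℝ (Fin d)))
    t).map_eq
  rw [← h1, integral_map (measurable_pi_apply t).aemeasurable (by fun_prop)] at h
  exact h

lemma integral_sq_sum_inner_gaussPath (c : Fin T → EuclideanSpace ℝ (Fin d)) :
    ∫ g : Path d T, (∑ t, inner ℝ (c t) (g t)) ^ 2 ∂(gaussPath d T) = ∑ t, ‖c t‖ ^ 2 := by
  have hm (t : Fin T) := (IsGaussian.memLp_two_id
    (μ := stdGaussian (EuclideanSpace ℝ (Fin d)))).const_inner (𝕜 := ℝ) (c t)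
  have h := variance_sum_pi (X := fun t x => inner ℝ (c t) x) hm
  rw [variance_of_integral_eq_zero] at h
  · have h2 (t : Fin T) : Var[fun x => inner ℝ (c t) x; stdGaussian (EuclideanSpace ℝ (Fin d))] =
        ‖c t‖ ^ 2 := by
      have := variance_dual_stdGaussian (innerSL ℝ (c t))
      rwa [innerSL_apply_norm] at this
    simp only [h2] at h
    rw [← h]
    simp [gaussPath]
  · refine Measurable.aemeasurable ?_
    fun_prop
  · have := fun t => integral_inner_gaussPath c t
    simp only [Finset.sum_apply]
    change ∫ g : Path d T, ∑ t, inner ℝ (c t) (g t) ∂(gaussPath d T) = 0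
    rw [integral_finsetSum _ fun t _ => (memLp_inner_gaussPath c t).integrable one_le_two]
    exact Finset.sum_eq_zero fun t _ => this t

end Moments

/-! ### Conditional and nested laws of functions of the Gaussian path. -/

section Gaussian

variable {d T : ℕ} {Ω : Type*} [MeasurableSpace Ω] (B : GaussianBasis d T Ω)

/-- The Gaussian path of a basis. -/
def gpath (ω : Ω) : Path d T := fun t => B.G t ω

lemma measurable_gpath : Measurable (gpath B) := measurable_pi_iff.2 B.measurable_G

lemma map_gpath : B.P.map (gpath B) = gaussPath d T := by
  have h := (iIndepFun_iff_map_fun_eq_pi_map fun t => (B.measurable_G t).aemeasurable).1 B.indep_G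
  simp only [B.law_G] at h
  exact h

lemma filt_eq_comap (n : ℕ) :
    B.filt n = MeasurableSpace.comap (fun ω => splice n (gpath B ω) 0) inferInstance := by
  refine le_antisymm (iSup₂_le fun s hs => ?_) ?_
  · have : B.G s = (fun g : Path d T => g s) ∘ fun ω => splice n (gpath B ω) 0 := by
      ext ω
      simp [splice, hs, gpath]
    rw [this, ← MeasurableSpace.comap_comp]
    exact MeasurableSpace.comap_mono (measurable_pi_apply s).comap_le
  · refine Measurable.comap_le (@measurable_pi_iff _ _ _ (B.filt n) _ _ |>.2 fun t => ?_)
    by_cases h : (t : ℕ) < n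
    · simp only [splice, h, if_true]
      exact (comap_measurable (B.G t)).mono
        (le_iSup₂_of_le (f := fun (s : Fin T) (_ : (s : ℕ) < n) =>
          MeasurableSpace.comap (B.G s) inferInstance) t h le_rfl) le_rfl
    · simp only [splice, h, if_false]
      exact measurable_const

lemma integral_sq_sum_inner (c : Fin T → EuclideanSpace ℝ (Fin d)) :
    ∫ ω, (∑ t, inner ℝ (c t) (B.G t ω)) ^ 2 ∂B.P = ∑ t, ‖c t‖ ^ 2 := by
  rw [← integral_sq_sum_inner_gaussPath, ← map_gpath B,
    integral_map (measurable_gpath B).aemeasurable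
      (Measurable.aestronglyMeasurable (by fun_prop))]
  rfl

variable [StandardBorelSpace Ω] {φ : Fin T → EuclideanSpace ℝ (Fin d) → EuclideanSpace ℝ (Fin d)}

/-- Given the first `n` vectors, the later ones are fresh independent Gaussians. The coordinatewise
`φ` commutes with splicing and preserves the Gaussian law, so the same holds for the transformed
path. -/
lemma condExpKernel_map_gpath
    (hφ : ∀ t, MeasurePreserving (φ t) (stdGaussian (EuclideanSpace ℝ (Fin d)))
      (stdGaussian (EuclideanSpace ℝ (Fin d)))) (n : ℕ) :
    ∀ᵐ ω ∂B.P, (condExpKernel B.P (B.filt n) ω).map (fun ω t => φ t (gpath B ω t)) =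
      (gaussPath d T).map (splice n fun t => φ t (gpath B ω t)) := by
  set Φ : Path d T → Path d T := fun g t => φ t (g t) with hΦ
  have hΦm : MeasurePreserving Φ (gaussPath d T) (gaussPath d T) := measurePreserving_pi _ _ hφ
  have hΦs (g x : Path d T) : Φ (splice n g x) = splice n (Φ g) (Φ x) := by
    ext t
    by_cases h : (t : ℕ) < n <;> simp [hΦ, splice, h]
  -- Zeroing the future makes the candidate kernel visibly measurable for `B.filt n`, without
  -- changing what `splice n` sees.
  set X : Ω → Path d T := fun ω => splice n (gpath B ω) 0 with hX
  have hXm : Measurable[B.filt n] X := by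
    rw [filt_eq_comap]; exact comap_measurable _
  let η : @Kernel Ω (Path d T) (B.filt n) _ :=
    @Kernel.mk Ω (Path d T) (B.filt n) _ (fun ω => (gaussPath d T).map (splice n (Φ (X ω))))
      (((measurable_map_splice n).comp hΦm.measurable).comp hXm)
  have hη (ω : Ω) : η ω = (gaussPath d T).map (splice n (Φ (gpath B ω))) := by
    change (gaussPath d T).map (splice n (Φ (X ω))) = _
    rw [hX]
    congr 1
    ext y t
    by_cases h : (t : ℕ) < n <;> simp [splice, h, hΦ]
  have hmark : IsMarkovKernel η := ⟨fun ω => by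
    rw [hη]
    exact Measure.isProbabilityMeasure_map (measurable_splice_right n _).aemeasurable⟩
  have key := condExpKernel_map_ae_eq (filt_le B n) (P := B.P)
    (hΦm.measurable.comp (measurable_gpath B)) η ?_
  · filter_upwards [key] with ω hω
    rw [← hη, ← hω]
    rfl
  intro A hA S hS
  rw [filt_eq_comap] at hA
  obtain ⟨D, hD, rfl⟩ := hA
  set D' : Set (Path d T) := (fun g => splice n g 0) ⁻¹' D with hD'
  have hD'm : MeasurableSet D' := measurable_splice_left n 0 hD
  have hG : MeasurePreserving (gpath B) B.P (gaussPath d T) := ⟨measurable_gpath B, map_gpath B⟩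
  have hSm : MeasurableSet (Φ ⁻¹' S) := hΦm.measurable hS
  have hf : Measurable fun g => ((gaussPath d T).map (splice n (Φ g))) S :=
    (Measure.measurable_coe hS).comp ((measurable_map_splice n).comp hΦm.measurable)
  calc B.P (gpath B ⁻¹' D' ∩ gpath B ⁻¹' (Φ ⁻¹' S))
      = gaussPath d T (D' ∩ Φ ⁻¹' S) := by
        rw [← Set.preimage_inter, hG.measure_preimage (hD'm.inter hSm).nullMeasurableSet]
    _ = ∫⁻ g, D'.indicator (fun g => ((gaussPath d T).map (splice n (Φ g))) S) g
          ∂(gaussPath d T) := by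
        conv_lhs => rw [← map_splice_gaussPath n]
        rw [Measure.map_apply (measurable_splice n) (hD'm.inter hSm),
          Measure.prod_apply (measurable_splice n (hD'm.inter hSm))]
        refine lintegral_congr fun g => ?_
        by_cases hg : g ∈ D'
        · rw [Set.indicator_of_mem hg, Measure.map_apply (measurable_splice_right n _) hS,
            ← hΦm.measure_preimage (measurable_splice_right n _ hS).nullMeasurableSet]
          congr 1
          ext x
          have hg' : splice n g 0 ∈ D := hg
          simp [hD', splice_splice_left, hg', hΦs]
        · rw [Set.indicator_of_notMem hg]
          convert measure_empty (μ := gaussPath d T)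
          ext x
          have hg' : splice n g 0 ∉ D := hg
          simp [hD', splice_splice_left, hg']
    _ = ∫⁻ g in D', ((gaussPath d T).map (splice n (Φ g))) S ∂(gaussPath d T) :=
        lintegral_indicator hD'm _
    _ = ∫⁻ ω in gpath B ⁻¹' D', η ω S ∂B.P := by
        simp only [hη]
        exact (hG.setLIntegral_comp_preimage hD'm hf).symm

/-- The nested law of a function of the Gaussian path does not change under measure preserving
transformations of the single Gaussian vectors. -/
lemma nestedLaw_comp_gpath
    (hφ : ∀ t, MeasurePreserving (φ t) (stdGaussian (EuclideanSpace ℝ (Fin d)))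
      (stdGaussian (EuclideanSpace ℝ (Fin d)))) {F : Path d T → Path d T} (hF : Measurable F) :
    B.nestedLaw (fun ω => F fun t => φ t (gpath B ω t)) =
      (gaussPath d T).map (nestedFn F (T - 1)) := by
  set Y : Ω → Path d T := fun ω t => φ t (gpath B ω t) with hY
  have hYm : MeasurePreserving Y B.P (gaussPath d T) :=
    (measurePreserving_pi _ _ hφ).comp ⟨measurable_gpath B, map_gpath B⟩
  have key (k : ℕ) : B.condNest (fun ω => F (Y ω)) k =ᵐ[B.P] fun ω => nestedFn F k (Y ω) := by
    induction k with
    | zero => rfl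
    | succ k ih =>
      -- A null set for `B.P` is null for almost every conditional measure, so the inductive
      -- identity may be used under the kernel.
      have h1 : ∀ᵐ ω ∂B.P, B.condNest (fun ω => F (Y ω)) k
          =ᵐ[condExpKernel B.P (B.filt (T - 1 - k)) ω] fun ω => nestedFn F k (Y ω) := by
        refine ae_of_ae_trim (filt_le B (T - 1 - k)) (Measure.ae_ae_of_ae_comp ?_)
        rw [condExpKernel_comp_trim]
        exact ih
      filter_upwards [h1, condExpKernel_map_gpath B hφ (T - 1 - k)] with ω h2 h3
      simp only [GaussianBasis.condNest, nestedFn]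
      rw [Measure.map_congr h2, ← h3, Measure.map_map (measurable_nestedFn hF k) hYm.measurable]
      rfl
  rw [GaussianBasis.nestedLaw, Measure.map_congr (key (T - 1)), ← hYm.map_eq,
    Measure.map_map (measurable_nestedFn hF _) hYm.measurable]
  rfl

/-- Linear functionals of the Gaussian path, conditionally on the past. -/
lemma condExp_sum_inner (c : Fin T → EuclideanSpace ℝ (Fin d)) (n : ℕ) :
    B.P[fun ω => ∑ t, inner ℝ (c t) (B.G t ω) | B.filt n] =ᵐ[B.P]
      fun ω => ∑ t : Fin T, inner ℝ (if (t : ℕ) < n then c t else 0) (B.G t ω) := by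
  set F : Path d T → ℝ := fun g => ∑ t, inner ℝ (c t) (g t) with hF
  have hG : MeasurePreserving (gpath B) B.P (gaussPath d T) := ⟨measurable_gpath B, map_gpath B⟩
  have hFm : Measurable F := by fun_prop
  have hFi : Integrable F (gaussPath d T) :=
    integrable_finsetSum _ fun t _ => (memLp_inner_gaussPath c t).integrable one_le_two
  have hint : Integrable (fun ω => F (gpath B ω)) B.P := hG.integrable_comp_of_integrable hFi
  have h1 := condExp_ae_eq_integral_condExpKernel (filt_le B n) hint
  have h2 := condExpKernel_map_gpath B (φ := fun _ x => x) (fun _ => MeasurePreserving.id _) n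
  filter_upwards [h1, h2] with ω hω1 hω2
  refine hω1.trans ?_
  have h3 := integral_map (μ := condExpKernel B.P (B.filt n) ω) (measurable_gpath B).aemeasurable
    (f := F) hFm.aestronglyMeasurable
  rw [← h3]
  have h4 : (condExpKernel B.P (B.filt n) ω).map (gpath B) =
      (gaussPath d T).map (splice n (gpath B ω)) := hω2
  rw [h4, integral_map (measurable_splice_right n _).aemeasurable hFm.aestronglyMeasurable]
  have h5 (x : Path d T) : F (splice n (gpath B ω) x) =
      ∑ t : Fin T, inner ℝ (if (t : ℕ) < n then c t else 0) (B.G t ω) +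
        ∑ t : Fin T, inner ℝ (if (t : ℕ) < n then 0 else c t) (x t) := by
    rw [hF, ← Finset.sum_add_distrib]
    refine Finset.sum_congr rfl fun t _ => ?_
    by_cases h : (t : ℕ) < n <;> simp [splice, h, gpath]
  simp only [h5]
  have h6 := fun t => memLp_inner_gaussPath (fun t : Fin T => if (t : ℕ) < n then 0 else c t) t
  rw [integral_add (integrable_const _)
    (integrable_finsetSum _ fun t _ => (h6 t).integrable one_le_two),
    integral_finsetSum _ fun t _ => (h6 t).integrable one_le_two]
  simp [integral_inner_gaussPath (fun t : Fin T => if (t : ℕ) < n then 0 else c t)]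

end Gaussian

lemma starProjection_congr {H : Type*} [NormedAddCommGroup H] [InnerProductSpace ℝ H]
    {U V : Submodule ℝ H} [U.HasOrthogonalProjection] [V.HasOrthogonalProjection] (h : U = V)
    (x : H) : U.starProjection x = V.starProjection x := by
  subst h; rfl

/-! ### The adapted Wasserstein distance as a minimum over `𝐎`. -/

section AdaptedPaths

open scoped Matrix

variable {d T : ℕ}

/-- Linear functionals on the path space. -/
def pairing (u : Fin T × Fin d → ℝ) (z : Path d T) : ℝ := ∑ p, u p * z p.1 p.2

lemma measurable_pairing (u : Fin T × Fin d → ℝ) : Measurable (pairing u : Path d T → ℝ) := by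
  unfold pairing; fun_prop

/-- The linear map of the path space given by a block matrix. -/
def matPath (A : Mat d T) (g : Path d T) : Path d T :=
  fun t => WithLp.toLp 2 fun i => ∑ s : Fin T, ∑ j : Fin d, A (t, i) (s, j) * g s j

lemma measurable_matPath (A : Mat d T) : Measurable (matPath A) := by
  unfold matPath; fun_prop

/-- The coefficients of the linear functional `u` of the process given by the matrix `A`. -/
def coeffs (u : Fin T × Fin d → ℝ) (A : Mat d T) (s : Fin T) : EuclideanSpace ℝ (Fin d) :=
  WithLp.toLp 2 (u ᵥ* blockCol A s)

lemma norm_sq_coeffs (u : Fin T × Fin d → ℝ) (A : Mat d T) (s : Fin T) :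
    ‖coeffs u A s‖ ^ 2 = (u ᵥ* blockCol A s) ⬝ᵥ (u ᵥ* blockCol A s) := by
  rw [EuclideanSpace.real_norm_sq_eq]
  simp [coeffs, dotProduct, sq]

lemma pairing_matPath (u : Fin T × Fin d → ℝ) (A : Mat d T) (g : Path d T) :
    pairing u (matPath A g) = ∑ s, inner ℝ (coeffs u A s) (g s) := by
  simp only [pairing, matPath, coeffs, PiLp.inner_apply, Matrix.vecMul, dotProduct, blockCol,
    Matrix.of_apply, Finset.mul_sum, RCLike.inner_apply, conj_trivial]
  rw [Finset.sum_comm]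
  refine Finset.sum_congr rfl fun s _ => ?_
  rw [Finset.sum_comm]
  refine Finset.sum_congr rfl fun j _ => Finset.sum_congr rfl fun p _ => ?_
  ring

/-- The action of a block-diagonal orthogonal matrix on a Gaussian vector. -/
lemma measurePreserving_toEuclideanLin {O : Matrix (Fin d) (Fin d) ℝ}
    (hO : O ∈ Matrix.orthogonalGroup (Fin d) ℝ) :
    MeasurePreserving (fun x => WithLp.toLp 2 (O *ᵥ WithLp.ofLp x))
      (stdGaussian (EuclideanSpace ℝ (Fin d))) (stdGaussian (EuclideanSpace ℝ (Fin d))) := by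
  let f : EuclideanSpace ℝ (Fin d) →ₗᵢ[ℝ] EuclideanSpace ℝ (Fin d) :=
    { toLinearMap := Matrix.toEuclideanLin O
      norm_map' := fun x => by
        refine (sq_eq_sq₀ (norm_nonneg _) (norm_nonneg _)).1 ?_
        rw [EuclideanSpace.real_norm_sq_eq, EuclideanSpace.real_norm_sq_eq]
        have h : (O *ᵥ WithLp.ofLp x) ⬝ᵥ (O *ᵥ WithLp.ofLp x) = WithLp.ofLp x ⬝ᵥ WithLp.ofLp x := by
          rw [Matrix.dotProduct_mulVec, ← Matrix.mulVec_transpose, Matrix.mulVec_mulVec,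
            orthogonal_transpose_mul hO, Matrix.one_mulVec]
        simpa [dotProduct, sq, Matrix.toLpLin_apply] using h }
  have h := stdGaussian_map (f.toLinearIsometryEquiv rfl)
  exact ⟨f.continuous.measurable, h⟩

variable {Ω : Type*} [MeasurableSpace Ω] (B : GaussianBasis d T Ω)

lemma memLp_coord {X : Ω → Path d T} (hX : X ∈ B.L2ad) (p : Fin T × Fin d) :
    MemLp (fun ω => X ω p.1 p.2) 2 B.P := by
  exact (EuclideanSpace.proj (𝕜 := ℝ) p.2).comp_memLp' (hX p.1).2

lemma L2ad_measurable {X : Ω → Path d T} (hX : X ∈ B.L2ad) : Measurable[B.filt T] X :=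
  @measurable_pi_iff _ _ _ (B.filt T) _ _ |>.2 fun t =>
    (hX t).1.mono (filt_mono B t.2) le_rfl

lemma memLp_pairing {X : Ω → Path d T} (hX : X ∈ B.L2ad) (u : Fin T × Fin d → ℝ) :
    MemLp (fun ω => pairing u (X ω)) 2 B.P :=
  memLp_finsetSum _ fun p _ => (memLp_coord B hX p).const_mul (u p)

/-- The closed subspaces of `L²` given by the filtration, except that the zeroth one is trivial. -/
def filtL2 (n : ℕ) : Submodule ℝ (Lp ℝ 2 B.P) :=
  if n = 0 then ⊥ else lpMeas ℝ ℝ (B.filt n) 2 B.P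

instance (n : ℕ) : (filtL2 B n).HasOrthogonalProjection := by
  unfold filtL2
  split_ifs
  · infer_instance
  · have : Fact (B.filt n ≤ ‹MeasurableSpace Ω›) := ⟨filt_le B n⟩
    infer_instance

lemma filtL2_mono : Monotone (filtL2 B) := by
  intro m n hmn
  by_cases hm : m = 0
  · simp [filtL2, hm]
  · have hn : n ≠ 0 := by omega
    simp only [filtL2, hm, hn, if_false]
    intro f hf
    exact AEStronglyMeasurable.mono (filt_mono B hmn) hf

lemma integral_sum_norm_sq_sub {X Y : Ω → Path d T} (hX : X ∈ B.L2ad) (hY : Y ∈ B.L2ad) :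
    ∫ ω, ∑ t, ‖X ω t - Y ω t‖ ^ 2 ∂B.P =
      ∑ p : Fin T × Fin d, ∫ ω, (X ω p.1 p.2 - Y ω p.1 p.2) ^ 2 ∂B.P := by
  have hi (p : Fin T × Fin d) : Integrable (fun ω => (X ω p.1 p.2 - Y ω p.1 p.2) ^ 2) B.P :=
    ((memLp_coord B hX p).sub (memLp_coord B hY p)).integrable_sq
  rw [← integral_finsetSum _ fun p _ => hi p]
  refine integral_congr_ae (Filter.Eventually.of_forall fun ω => ?_)
  simp only [EuclideanSpace.real_norm_sq_eq, Fintype.sum_prod_type, PiLp.sub_apply]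

lemma process_eq (L : lowerBlock d T) (ω : Ω) : B.process L ω = matPath L (gpath B ω) := rfl

lemma process_mem_L2ad (L : lowerBlock d T) : B.process L ∈ B.L2ad := by
  intro t
  have hG (s : Fin T) : MemLp (B.G s) 2 B.P :=
    (IsGaussian.memLp_two_id (μ := stdGaussian (EuclideanSpace ℝ (Fin d)))).comp_measurePreserving
      ⟨B.measurable_G s, B.law_G s⟩
  constructor
  · refine (WithLp.measurable_toLp 2 _).comp (@measurable_pi_iff _ _ _ (B.filt (t + 1)) _ _ |>.2
      fun i => ?_)
    refine Finset.measurable_fun_sum _ fun s _ => Finset.measurable_fun_sum _ fun j _ => ?_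
    by_cases h : t < s
    · simp only [L.2 (t, i) (s, j) h, zero_mul]
      exact measurable_const
    · have hs : (s : ℕ) < t + 1 := Nat.lt_succ_of_le (not_lt.1 h)
      have h1 : Measurable[B.filt (t + 1)] (B.G s) := (comap_measurable (B.G s)).mono
        (le_iSup₂_of_le (f := fun (s : Fin T) (_ : (s : ℕ) < t + 1) =>
          MeasurableSpace.comap (B.G s) inferInstance) s hs le_rfl) le_rfl
      have h2 : Measurable fun x : EuclideanSpace ℝ (Fin d) =>
        (L : Mat d T) (t, i) (s, j) * x j := by fun_prop
      exact h2.comp h1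
  · have h (ω : Ω) : B.process L ω t = ∑ s : Fin T, (Matrix.toEuclideanLin
        (Matrix.of fun i j => (L : Mat d T) (t, i) (s, j))).toContinuousLinearMap (B.G s ω) := by
      ext i
      simp [GaussianBasis.process, Matrix.mulVec, dotProduct]
    simp only [h]
    exact memLp_finsetSum _ fun s _ => ContinuousLinearMap.comp_memLp' _ (hG s)

lemma integral_norm_sq_process_sub (L M : lowerBlock d T) :
    ∫ ω, ∑ t, ‖B.process L ω t - B.process M ω t‖ ^ 2 ∂B.P = ‖(L : Mat d T) - (M : Mat d T)‖ ^ 2 := by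
  set A : Mat d T := (L : Mat d T) - (M : Mat d T) with hA
  have h1 (p : Fin T × Fin d) (ω : Ω) : B.process L ω p.1 p.2 - B.process M ω p.1 p.2 =
      ∑ s, inner ℝ (coeffs (Pi.single p 1) A s) (B.G s ω) := by
    have := pairing_matPath (Pi.single p 1) A (gpath B ω)
    rw [show ∑ s, inner ℝ (coeffs (Pi.single p 1) A s) (B.G s ω) =
      pairing (Pi.single p 1) (matPath A (gpath B ω)) from this.symm]
    simp [pairing, Pi.single_apply, process_eq, matPath, hA, sub_mul, Finset.sum_sub_distrib]
  rw [integral_sum_norm_sq_sub B (process_mem_L2ad B L) (process_mem_L2ad B M)]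
  simp only [h1, integral_sq_sum_inner, norm_sq_coeffs, frobenius_norm_sq]
  refine Finset.sum_congr rfl fun p _ => ?_
  rw [Fintype.sum_prod_type]
  simp [dotProduct, blockCol]

variable [StandardBorelSpace Ω]

lemma nestedLaw_process_rot (L : lowerBlock d T) (O : blockOrth d T) :
    B.nestedLaw (B.process (rot L O)) = B.nestedLaw (B.process L) := by
  obtain ⟨O, P, hP, rfl⟩ := O
  have h1 : B.process (rot L ⟨blockDiag P, P, hP, rfl⟩) =
      fun ω => matPath L fun t => WithLp.toLp 2 (P t *ᵥ WithLp.ofLp (gpath B ω t)) := by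
    ext ω t i
    simp only [GaussianBasis.process, rot, matPath, Matrix.mul_apply, Fintype.sum_prod_type,
      blockDiag, Matrix.of_apply, Matrix.mulVec, dotProduct, gpath, Finset.sum_mul, Finset.mul_sum]
    refine Finset.sum_congr rfl fun s _ => ?_
    have h2 (j : Fin d) : ∑ r : Fin T, ∑ k : Fin d, (L : Mat d T) (t, i) (r, k) *
        (if r = s then P r k j else 0) * B.G s ω j =
        ∑ k : Fin d, (L : Mat d T) (t, i) (s, k) * P s k j * B.G s ω j := by
      rw [Finset.sum_eq_single s]
      · simp
      · intro r _ hr; simp [hr]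
      · simp
    simp only [h2]
    rw [Finset.sum_comm]
    exact Finset.sum_congr rfl fun k _ => Finset.sum_congr rfl fun j _ => mul_assoc _ _ _
  rw [h1, nestedLaw_comp_gpath B (φ := fun t x => WithLp.toLp 2 (P t *ᵥ WithLp.ofLp x))
    (fun t => measurePreserving_toEuclideanLin (hP t)) (measurable_matPath (L : Mat d T))]
  exact (nestedLaw_comp_gpath B (φ := fun _ x => x) (fun _ => MeasurePreserving.id _)
    (measurable_matPath (L : Mat d T))).symm

/-- The projection is a conditional expectation, whose second moment depends only on the nested law.
It can thus be computed for the process of `L`, where conditioning drops the Gaussian vectors from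
index `n` on. -/
lemma norm_sq_starProjection_filtL2 {X : Ω → Path d T} (hX : X ∈ B.L2ad) (L : lowerBlock d T)
    (hL : B.nestedLaw X = B.nestedLaw (B.process L)) {n : ℕ} (hn : n ≤ T)
    (u : Fin T × Fin d → ℝ) :
    ‖(filtL2 B n).starProjection (∑ p, u p • (memLp_coord B hX p).toLp)‖ ^ 2 =
      ∑ s : Fin T, if (s : ℕ) < n then
        (u ᵥ* blockCol (L : Mat d T) s) ⬝ᵥ (u ᵥ* blockCol (L : Mat d T) s) else 0 := by
  -- Level zero is `⊥` rather than the constants, so both sides vanish and the means need no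
  -- separate treatment.
  by_cases hn0 : n = 0
  · subst hn0
    have h : (filtL2 B 0).starProjection (∑ p, u p • (memLp_coord B hX p).toLp) ∈ filtL2 B 0 :=
      Submodule.starProjection_apply_mem _ _
    have h0 : filtL2 B 0 = ⊥ := if_pos rfl
    rw [(Submodule.mem_bot ℝ).1 (h0.le h)]
    simp
  have hm := filt_le B n
  have : Fact (B.filt n ≤ ‹MeasurableSpace Ω›) := ⟨hm⟩
  have hpX := memLp_pairing B hX u
  have hpL := memLp_pairing B (process_mem_L2ad B L) u
  have hsum : ∑ p, u p • (memLp_coord B hX p).toLp = hpX.toLp := by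
    refine Lp.ext ?_
    have h1 : ∀ᵐ ω ∂B.P, ∀ p, ((u p • (memLp_coord B hX p).toLp : Lp ℝ 2 B.P) : Ω → ℝ) ω =
        u p * X ω p.1 p.2 := by
      refine ae_all_iff.2 fun p => ?_
      filter_upwards [Lp.coeFn_smul (u p) (memLp_coord B hX p).toLp,
        (memLp_coord B hX p).coeFn_toLp] with ω h2 h3
      rw [h2, Pi.smul_apply, h3, smul_eq_mul]
    filter_upwards [h1, hpX.coeFn_toLp,
      Lp.coeFn_finsetSum Finset.univ fun p => u p • (memLp_coord B hX p).toLp] with ω h2 h3 h4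
    rw [h4, h3, Finset.sum_apply]
    exact Finset.sum_congr rfl fun p _ => h2 p
  have hstar : (filtL2 B n).starProjection hpX.toLp =
      (condExpL2 ℝ ℝ hm hpX.toLp : Lp ℝ 2 B.P) :=
    starProjection_congr (U := filtL2 B n) (V := lpMeas ℝ ℝ (B.filt n) 2 B.P) (if_neg hn0) _
  rw [hsum, hstar, ← real_inner_self_eq_norm_sq, L2.inner_def]
  have h1 : ∀ Z ∈ B.L2ad, ∫ ω, (B.P[fun ω => pairing u (Z ω) | B.filt n] ω) ^ 2 ∂B.P =
      ∫ y, y ^ 2 ∂(B.P.map (B.P[fun ω => pairing u (Z ω) | B.filt n])) := fun Z _ => by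
    rw [integral_map (stronglyMeasurable_condExp.mono hm).measurable.aemeasurable
      (Measurable.aestronglyMeasurable (by fun_prop))]
  calc ∫ ω, inner ℝ ((condExpL2 ℝ ℝ hm hpX.toLp : Lp ℝ 2 B.P) ω)
        ((condExpL2 ℝ ℝ hm hpX.toLp : Lp ℝ 2 B.P) ω) ∂B.P
      = ∫ ω, (B.P[fun ω => pairing u (X ω) | B.filt n] ω) ^ 2 ∂B.P := by
        refine integral_congr_ae ?_
        filter_upwards [hpX.condExpL2_ae_eq_condExp (𝕜 := ℝ) hm] with ω hω
        rw [hω, real_inner_self_eq_norm_sq, Real.norm_eq_abs, sq_abs]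
    _ = ∫ ω, (B.P[fun ω => pairing u (B.process L ω) | B.filt n] ω) ^ 2 ∂B.P := by
        rw [h1 X hX, h1 _ (process_mem_L2ad B L), map_condExp_eq B (L2ad_measurable B hX)
          (L2ad_measurable B (process_mem_L2ad B L)) hL (measurable_pairing u)
          (hpX.integrable one_le_two) (hpL.integrable one_le_two) (Nat.pos_of_ne_zero hn0) hn]
    _ = ∫ ω, (∑ s : Fin T, inner ℝ (if (s : ℕ) < n then coeffs u (L : Mat d T) s else 0)
          (B.G s ω)) ^ 2 ∂B.P := by
        refine integral_congr_ae ?_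
        simp only [process_eq, pairing_matPath]
        filter_upwards [condExp_sum_inner B (coeffs u (L : Mat d T)) n] with ω hω
        exact congrArg (· ^ 2) hω
    _ = _ := by
        rw [integral_sq_sum_inner]
        refine Finset.sum_congr rfl fun s _ => ?_
        split_ifs
        · exact norm_sq_coeffs _ _ _
        · simp

lemma exists_blockOrth_le {X Y : Ω → Path d T} (hX : X ∈ B.L2ad) (hY : Y ∈ B.L2ad)
    (L M : lowerBlock d T) (hL : B.nestedLaw X = B.nestedLaw (B.process L))
    (hM : B.nestedLaw Y = B.nestedLaw (B.process M)) :
    ∃ O ∈ blockOrth d T, ‖(L : Mat d T) - (M : Mat d T) * O‖ ^ 2 ≤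
      ∫ ω, ∑ t, ‖X ω t - Y ω t‖ ^ 2 ∂B.P := by
  have hmem {Z : Ω → Path d T} (hZ : Z ∈ B.L2ad) (p : Fin T × Fin d) :
      (memLp_coord B hZ p).toLp ∈ filtL2 B T := by
    have hT : T ≠ 0 := fun h => by subst h; exact p.1.elim0
    rw [filtL2, if_neg hT, mem_lpMeas_iff_aestronglyMeasurable]
    refine AEStronglyMeasurable.congr ?_ (memLp_coord B hZ p).coeFn_toLp.symm
    have h1 : Measurable fun z : Path d T => z p.1 p.2 := by fun_prop
    exact (h1.comp (L2ad_measurable B hZ)).stronglyMeasurable.aestronglyMeasurable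
  obtain ⟨O, hO, h⟩ := exists_blockOrth_norm_sub_le (filtL2 B) (filtL2_mono B) (if_pos rfl)
    (L : Mat d T) (M : Mat d T) (fun p => (memLp_coord B hX p).toLp)
    (fun p => (memLp_coord B hY p).toLp) (hmem hX) (hmem hY)
    (fun n hn u => norm_sq_starProjection_filtL2 B hX L hL hn u)
    (fun n hn u => norm_sq_starProjection_filtL2 B hY M hM hn u)
  refine ⟨O, hO, h.trans_eq ?_⟩
  rw [integral_sum_norm_sq_sub B hX hY]
  refine Finset.sum_congr rfl fun p _ => ?_
  rw [← MemLp.toLp_sub, ← real_inner_self_eq_norm_sq, L2.inner_def]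
  refine integral_congr_ae ?_
  filter_upwards [((memLp_coord B hX p).sub (memLp_coord B hY p)).coeFn_toLp] with ω hω
  rw [hω, real_inner_self_eq_norm_sq, Real.norm_eq_abs, sq_abs]
  rfl

/-- The infimum is attained by the processes of `L` and `M P`, and Gelbrich's inequality shows that
no admissible pair does better. -/
lemma dABW_eq (L M : lowerBlock d T) {P : Mat d T} (hP : P ∈ blockOrth d T)
    (h : ∀ O ∈ blockOrth d T, ‖(L : Mat d T) - (M : Mat d T) * P‖ ≤ ‖(L : Mat d T) - (M : Mat d T) * O‖) :
    dABW B L M = ‖(L : Mat d T) - (M : Mat d T) * P‖ := by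
  have : IsLeast {c : ℝ | ∃ X' ∈ B.L2ad, ∃ Y' ∈ B.L2ad,
      B.nestedLaw X' = B.nestedLaw (B.process L) ∧ B.nestedLaw Y' = B.nestedLaw (B.process M) ∧
      c = ∫ ω, ∑ t, ‖X' ω t - Y' ω t‖ ^ 2 ∂B.P} (‖(L : Mat d T) - (M : Mat d T) * P‖ ^ 2) := by
    constructor
    · exact ⟨_, process_mem_L2ad B L, _, process_mem_L2ad B (rot M ⟨P, hP⟩), rfl,
        nestedLaw_process_rot B M ⟨P, hP⟩, (integral_norm_sq_process_sub B L (rot M ⟨P, hP⟩)).symm⟩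
    · rintro c ⟨X, hX, Y, hY, hXL, hYM, rfl⟩
      obtain ⟨O, hO, hle⟩ := exists_blockOrth_le B hX hY L M hXL hYM
      exact (pow_le_pow_left₀ (norm_nonneg _) (h O hO) 2).trans hle
  rw [dABW, GaussianBasis.AW, this.csInf_eq, Real.sqrt_sq (norm_nonneg _)]

lemma exists_optimal (L M : lowerBlock d T) :
    ∃ P ∈ blockOrth d T, ∀ O ∈ blockOrth d T,
      ‖(L : Mat d T) - (M : Mat d T) * P‖ ≤ ‖(L : Mat d T) - (M : Mat d T) * O‖ := by
  obtain ⟨P, hP, h⟩ := exists_norm_sub_le (L : Mat d T) (M : Mat d T)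
  refine ⟨P, hP, fun O hO => ?_⟩
  have := h (P.transpose * O) (mul_mem_blockOrth (blockOrth_transpose_mem hP) hO)
  rwa [Matrix.mul_assoc, ← Matrix.mul_assoc P, blockOrth_mul_transpose hP, Matrix.one_mul] at this

lemma dABW_le (L M : lowerBlock d T) {O : Mat d T} (hO : O ∈ blockOrth d T) :
    dABW B L M ≤ ‖(L : Mat d T) - (M : Mat d T) * O‖ := by
  obtain ⟨P, hP, h⟩ := exists_optimal L M
  rw [dABW_eq B L M hP h]
  exact h O hO

lemma qdist_toClass (L M : lowerBlock d T) : qdist B (toClass L) (toClass M) = dABW B L M := by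
  refine IsLeast.csInf_eq ⟨⟨L, M, rfl, rfl, rfl⟩, ?_⟩
  rintro c ⟨L', M', hL, hM, rfl⟩
  obtain ⟨O₁, hO₁, h₁⟩ := toClass_eq_iff.1 hL
  obtain ⟨O₂, hO₂, h₂⟩ := toClass_eq_iff.1 hM
  obtain ⟨P, hP, h⟩ := exists_optimal L' M'
  rw [dABW_eq B L' M' hP h, h₁, h₂, ← norm_mul_blockOrth _ (blockOrth_transpose_mem hO₁),
    Matrix.sub_mul, Matrix.mul_assoc, blockOrth_mul_transpose hO₁, Matrix.mul_one,
    Matrix.mul_assoc, Matrix.mul_assoc]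
  exact dABW_le B L M (mul_mem_blockOrth hO₂ (mul_mem_blockOrth hP (blockOrth_transpose_mem hO₁)))

lemma qdist_le_norm (L M : lowerBlock d T) : qdist B (toClass L) (toClass M) ≤ ‖L - M‖ := by
  rw [qdist_toClass]
  refine (dABW_le B L M (one_mem_blockOrth d T)).trans_eq ?_
  rw [Matrix.mul_one]
  rfl

/-- Any class has a representative optimally aligned with a given `L`; such lifts transfer metric
arguments to Euclidean space. -/
lemma exists_qdist_eq_norm (L : lowerBlock d T) (x : Space d T) :
    ∃ M, toClass M = x ∧ qdist B (toClass L) x = ‖L - M‖ := by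
  obtain ⟨M, rfl⟩ := Quotient.exists_rep x
  obtain ⟨P, hP, h⟩ := exists_optimal L M
  refine ⟨rot M ⟨P, hP⟩, toClass_rot M ⟨P, hP⟩, ?_⟩
  change qdist B (toClass L) (toClass M) = _
  rw [qdist_toClass, dABW_eq B L M hP h]
  rfl

end AdaptedPaths

/-! ### Geodesics of the quotient. -/

section QuotientMetric

variable {d T : ℕ} {Ω : Type*} [MeasurableSpace Ω] [StandardBorelSpace Ω] (B : GaussianBasis d T Ω)

lemma exists_toClass_eq (x : Space d T) : ∃ L, toClass L = x := Quotient.exists_rep x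

lemma qdist_comm_le (x y : Space d T) : qdist B x y ≤ qdist B y x := by
  obtain ⟨M, rfl⟩ := exists_toClass_eq y
  obtain ⟨L, rfl, h⟩ := exists_qdist_eq_norm B M x
  rw [h, norm_sub_rev]
  exact qdist_le_norm B L M

lemma qdist_comm (x y : Space d T) : qdist B x y = qdist B y x :=
  le_antisymm (qdist_comm_le B x y) (qdist_comm_le B y x)

lemma qdist_triangle (x y z : Space d T) : qdist B x z ≤ qdist B x y + qdist B y z := by
  obtain ⟨L, rfl⟩ := exists_toClass_eq x
  obtain ⟨M, rfl, h⟩ := exists_qdist_eq_norm B L y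
  obtain ⟨N, rfl, h'⟩ := exists_qdist_eq_norm B M z
  rw [h, h']
  exact (qdist_le_norm B L N).trans (norm_sub_le_norm_sub_add_norm_sub L M N)

lemma qdist_self (x : Space d T) : qdist B x x = 0 := by
  obtain ⟨L, rfl⟩ := exists_toClass_eq x
  obtain ⟨M, -, h⟩ := exists_qdist_eq_norm B L (toClass L)
  refine le_antisymm ((qdist_le_norm B L L).trans_eq (by simp)) ?_
  rw [h]
  exact norm_nonneg _

lemma forall_norm_le_iff (L V : lowerBlock d T) :
    (∀ O ∈ blockOrth d T, ‖V‖ ≤ ‖(L : Mat d T) - ((L + V : lowerBlock d T) : Mat d T) * O‖) ↔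
      qdist B (toClass L) (toClass (L + V)) = ‖V‖ := by
  have h0 : ‖(L : Mat d T) - ((L + V : lowerBlock d T) : Mat d T) * 1‖ = ‖V‖ := by
    rw [Matrix.mul_one, Submodule.coe_add, sub_add_cancel_left, norm_neg]
    rfl
  rw [qdist_toClass]
  constructor
  · intro h
    rw [dABW_eq B L (L + V) (one_mem_blockOrth d T) fun O hO => h0.trans_le (h O hO), h0]
  · intro h O hO
    rw [← h]
    exact dABW_le B L (L + V) hO

lemma mem_bfV_iff (L V : lowerBlock d T) :
    V ∈ bfV L ↔ qdist B (toClass L) (toClass (L + V)) = ‖V‖ := by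
  constructor
  · rintro ⟨M, P, ⟨hP, hopt⟩, hV⟩
    have h1 : L + V = rot M ⟨P, hP⟩ := by
      apply Subtype.ext
      rw [Submodule.coe_add, hV]
      simp [rot]
    rw [h1, toClass_rot, qdist_toClass, dABW_eq B L M hP hopt, norm_sub_rev, ← hV]
    rfl
  · intro h
    refine ⟨L + V, 1, ⟨one_mem_blockOrth d T, fun O hO => ?_⟩, by simp⟩
    refine le_trans (le_of_eq ?_) ((forall_norm_le_iff B L V).2 h O hO)
    rw [Matrix.mul_one, Submodule.coe_add, sub_add_cancel_left, norm_neg]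
    rfl

lemma norm_add_smul_sub_add_smul {E : Type*} [NormedAddCommGroup E] [NormedSpace ℝ E] (x v : E)
    (a b : ℝ) : ‖(x + a • v) - (x + b • v)‖ = |a - b| * ‖v‖ := by
  rw [add_sub_add_left_eq_sub, ← sub_smul, norm_smul, Real.norm_eq_abs]

lemma add_zero_smul {E : Type*} [NormedAddCommGroup E] [NormedSpace ℝ E] (x v : E) :
    x + (0 : ℝ) • v = x := by
  rw [zero_smul, add_zero]

lemma eq_of_add_half_smul_sub_left {E : Type*} [NormedAddCommGroup E] [NormedSpace ℝ E]
    {x x' z : E} (h : x + (1 / 2 : ℝ) • (z - x) = x' + (1 / 2 : ℝ) • (z - x')) : x' = x := by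
  have h2 : (1 / 2 : ℝ) • (x' - x) = 0 := by
    calc (1 / 2 : ℝ) • (x' - x)
        = (x' + (1 / 2 : ℝ) • (z - x')) - (x + (1 / 2 : ℝ) • (z - x)) := by module
      _ = 0 := by rw [h, sub_self]
  simpa [sub_eq_zero] using h2

lemma eq_of_add_half_smul_sub_right {E : Type*} [NormedAddCommGroup E] [NormedSpace ℝ E]
    {x z z' : E} (h : x + (1 / 2 : ℝ) • (z - x) = x + (1 / 2 : ℝ) • (z' - x)) : z' = z := by
  have h2 : (1 / 2 : ℝ) • (z' - z) = 0 := by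
    calc (1 / 2 : ℝ) • (z' - z)
        = (x + (1 / 2 : ℝ) • (z' - x)) - (x + (1 / 2 : ℝ) • (z - x)) := by module
      _ = 0 := by rw [h, sub_self]
  simpa [sub_eq_zero] using h2

/-- Each piece of the segment projects to distance at most its length, and the endpoints are at
distance `‖V‖`, so the triangle inequality leaves no slack. -/
lemma qdist_segment {L V : lowerBlock d T} (hV : V ∈ bfV L) (u v : unitInterval) :
    qdist B (toClass (L + (u : ℝ) • V)) (toClass (L + (v : ℝ) • V)) = |(u : ℝ) - v| * ‖V‖ := by
  have hle (a b : ℝ) : qdist B (toClass (L + a • V)) (toClass (L + b • V)) ≤ |a - b| * ‖V‖ := by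
    refine (qdist_le_norm B _ _).trans_eq ?_
    exact norm_add_smul_sub_add_smul L V a b
  have main (u v : unitInterval) (huv : (u : ℝ) ≤ v) :
      |(u : ℝ) - v| * ‖V‖ ≤ qdist B (toClass (L + (u : ℝ) • V)) (toClass (L + (v : ℝ) • V)) := by
    have h1 := (mem_bfV_iff B L V).1 hV
    have h2 := qdist_triangle B (toClass L) (toClass (L + (u : ℝ) • V)) (toClass (L + V))
    have h3 := qdist_triangle B (toClass (L + (u : ℝ) • V)) (toClass (L + (v : ℝ) • V))
      (toClass (L + V))
    have h4 := hle 0 u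
    have h5 := hle v 1
    rw [zero_smul, add_zero, zero_sub, abs_neg, abs_of_nonneg u.2.1] at h4
    rw [one_smul, abs_sub_comm, abs_of_nonneg (sub_nonneg.2 v.2.2)] at h5
    rw [abs_sub_comm, abs_of_nonneg (sub_nonneg.2 huv)]
    nlinarith
  refine le_antisymm (hle u v) ?_
  rcases le_total (u : ℝ) v with h | h
  · exact main u v h
  · rw [qdist_comm, abs_sub_comm]
    exact main v u h

/-- The geodesic `u ↦ [L + u V]`. -/
def segGeod {L V : lowerBlock d T} (hV : V ∈ bfV L) : Geod B (toClass L) :=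
  ⟨fun u => toClass (L + (u : ℝ) • V), congrArg toClass (add_zero_smul L V), fun u v => by
    have h : |((0 : unitInterval) : ℝ) - (1 : unitInterval)| = 1 := by norm_num
    rw [qdist_segment B hV, qdist_segment B hV, h, one_mul]⟩

lemma eq_of_norm_sub_le {E : Type*} [NormedAddCommGroup E] [InnerProductSpace ℝ E] {x y z : E}
    {v D : ℝ} (h₁ : ‖x - y‖ ≤ v * D) (h₂ : ‖y - z‖ ≤ (1 - v) * D) (h₃ : D ≤ ‖x - z‖) :
    y = x + v • (z - x) := by
  have h := norm_sub_le_norm_sub_add_norm_sub x y z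
  have hD : ‖x - z‖ = D := by linarith
  have e₁ : dist x y = v * dist x z := by rw [dist_eq_norm, dist_eq_norm, hD]; linarith
  have e₂ : dist y z = (1 - v) * dist x z := by rw [dist_eq_norm, dist_eq_norm, hD]; linarith
  rw [eq_lineMap_of_dist_eq_mul_of_dist_eq_mul e₁ e₂, AffineMap.lineMap_apply]
  simp [add_comm]

/-- Geodesics emanating from `[L]` are segments. -/
lemma exists_segment {L : lowerBlock d T} (γ : Geod B (toClass L)) :
    ∃ V ∈ bfV L, ∀ u : unitInterval, γ.1 u = toClass (L + (u : ℝ) • V) := by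
  obtain ⟨γ, h0, hγ⟩ := γ
  set D := qdist B (γ 0) (γ 1) with hD
  let half : unitInterval := ⟨1 / 2, by norm_num, by norm_num⟩
  have hhalf : (half : ℝ) = 1 / 2 := rfl
  -- The midpoint is the anchor: `N` is aligned with `L`, and all further lifts are aligned with
  -- `N`. Lifting each `γ v` relative to `L` might scatter the lifts over several segments.
  obtain ⟨N, hN, hLN⟩ := exists_qdist_eq_norm B L (γ half)
  rw [← h0, hγ, hhalf] at hLN
  have hLN' : ‖L - N‖ = 1 / 2 * D := by rw [← hLN]; norm_num
  obtain ⟨M, hM, hNM⟩ := exists_qdist_eq_norm B N (γ 1)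
  rw [hN, hγ, hhalf] at hNM
  have hNM' : ‖N - M‖ = 1 / 2 * D := by rw [← hNM]; norm_num [abs_of_nonneg]
  have hLM : D ≤ ‖L - M‖ := by rw [hD, h0, ← hM]; exact qdist_le_norm B L M
  have hmid := eq_of_norm_sub_le (v := 1 / 2) hLN'.le (by linarith) hLM
  have hLM' : ‖L - M‖ = D := by
    have := norm_sub_le_norm_sub_add_norm_sub L N M
    linarith
  refine ⟨M - L, (mem_bfV_iff B L _).2 ?_, fun v => ?_⟩
  · rw [add_sub_cancel, hM, norm_sub_rev, hLM', hD, h0]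
  obtain ⟨K, hK, hNK⟩ := exists_qdist_eq_norm B N (γ v)
  rw [hN, hγ, hhalf] at hNK
  suffices K = L + (v : ℝ) • (M - L) by rw [← this, hK]
  rcases le_total (v : ℝ) (1 / 2) with hv | hv
  · rw [abs_of_nonneg (by linarith)] at hNK
    obtain ⟨L', hL', hKL'⟩ := exists_qdist_eq_norm B K (γ 0)
    rw [hK, hγ] at hKL'
    have hv0 : |(v : ℝ) - (0 : unitInterval)| = v := by simp [abs_of_nonneg v.2.1]
    rw [hv0] at hKL'
    have hL'M : D ≤ ‖L' - M‖ := by rw [hD, ← hL', ← hM]; exact qdist_le_norm B L' M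
    have h1 := norm_sub_le_norm_sub_add_norm_sub L' K N
    rw [norm_sub_rev L' K, norm_sub_rev K N] at h1
    have hmid' := eq_of_norm_sub_le (v := 1 / 2) (x := L') (y := N) (z := M) (D := D)
      (by linarith) (by linarith) hL'M
    -- The path `L'`, `K`, `N`, `M` has total length `D`, so it is straight with midpoint `N`. As
    -- `N` is also the midpoint of `L` and `M`, the ends `L'` and `L` coincide.
    have hLL' : L' = L := by
      rw [hmid] at hmid'
      exact eq_of_add_half_smul_sub_left hmid'
    subst hLL'
    have h3 := norm_sub_le_norm_sub_add_norm_sub K N M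
    refine eq_of_norm_sub_le (D := D) ?_ ?_ hLM
    · rw [norm_sub_rev]; exact hKL'.ge
    · rw [norm_sub_rev K N] at h3
      linarith
  · rw [abs_sub_comm, abs_of_nonneg (by linarith)] at hNK
    obtain ⟨M', hM', hKM'⟩ := exists_qdist_eq_norm B K (γ 1)
    rw [hK, hγ] at hKM'
    have hv1 : |(v : ℝ) - (1 : unitInterval)| = 1 - v := by
      rw [abs_sub_comm]; simp [abs_of_nonneg, v.2.2]
    rw [hv1] at hKM'
    have hLM'' : D ≤ ‖L - M'‖ := by rw [hD, h0, ← hM']; exact qdist_le_norm B L M'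
    have h1 := norm_sub_le_norm_sub_add_norm_sub N K M'
    have hmid' := eq_of_norm_sub_le (v := 1 / 2) (x := L) (y := N) (z := M') (D := D)
      (by linarith) (by linarith) hLM''
    have hMM' : M' = M := by
      rw [hmid] at hmid'
      exact eq_of_add_half_smul_sub_right hmid'
    subst hMM'
    have h3 := norm_sub_le_norm_sub_add_norm_sub L N K
    exact eq_of_norm_sub_le (D := D) (by linarith) hKM'.ge hLM

end QuotientMetric

/-! ### Horizontal vectors and the fibre through `L`. -/

section Horizontal

open scoped Matrix

variable {d T : ℕ}

local notation "⟪" x ", " y "⟫" => inner ℝ x y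

lemma bfV_subset_calV {L V : lowerBlock d T} (hV : V ∈ bfV L) : V ∈ calV L := by
  obtain ⟨M, P, ⟨hP, hopt⟩, hV⟩ := hV
  intro t
  have h1 := isSymm_of_norm_sub_le (L := (L : Mat d T)) (M := (M : Mat d T) * P) (fun O hO => by
    rw [Matrix.mul_assoc]
    exact hopt _ (mul_mem_blockOrth hP hO)) t
  have h2 : diagBlock ((V : Mat d T).transpose * (L : Mat d T)) t =
      (diagBlock ((L : Mat d T).transpose * ((M : Mat d T) * P)) t).transpose -
        diagBlock ((L : Mat d T).transpose * (L : Mat d T)) t := by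
    ext i j
    simp only [hV, diagBlock, Matrix.of_apply, Matrix.sub_apply, Matrix.transpose_apply,
      Matrix.transpose_sub, Matrix.sub_mul]
    congr 1
    have h4 : ((L : Mat d T).transpose * ((M : Mat d T) * P)).transpose =
        ((M : Mat d T) * P).transpose * (L : Mat d T) := by
      rw [Matrix.transpose_mul, Matrix.transpose_transpose]
    exact (congrFun (congrFun h4 (t, i)) (t, j)).symm
  have h3 : (diagBlock ((L : Mat d T).transpose * (L : Mat d T)) t).IsSymm := by
    ext i j
    simp only [diagBlock, Matrix.of_apply, Matrix.transpose_apply]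
    rw [← Matrix.transpose_apply ((L : Mat d T).transpose * _), Matrix.transpose_mul,
      Matrix.transpose_transpose]
  rw [h2]
  exact h1.transpose.sub h3

/-- Block-diagonal matrices. -/
def diagSubmodule (d T : ℕ) : Submodule ℝ (Mat d T) where
  carrier := {A | ∀ p q : Fin T × Fin d, p.1 ≠ q.1 → A p q = 0}
  add_mem' hA hB p q h := by simp [hA p q h, hB p q h]
  zero_mem' p q _ := rfl
  smul_mem' c A hA p q h := by simp [hA p q h]

lemma one_sub_mem_diagSubmodule {O : Mat d T} (hO : O ∈ blockOrth d T) :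
    1 - O ∈ diagSubmodule d T := by
  obtain ⟨P, -, rfl⟩ := hO
  rw [← blockDiag_one]
  intro p q h
  simp [blockDiag, h]

/-- Positive definiteness of the blocks `(Lᵀ L)_{t,t}` makes `A ↦ L A` injective on block-diagonal
matrices, and an injective linear map in finite dimension is bounded below. -/
lemma exists_mul_norm_le {L : lowerBlock d T} (hL : IsReg L) :
    ∃ c : ℝ, 0 < c ∧ ∀ O ∈ blockOrth d T, c * ‖1 - O‖ ≤ ‖(L : Mat d T) * (1 - O)‖ := by
  let f : diagSubmodule d T →ₗ[ℝ] Mat d T :=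
    (LinearMap.mulLeft ℝ (L : Mat d T)).comp (diagSubmodule d T).subtype
  have hf : LinearMap.ker f = ⊥ := by
    rw [LinearMap.ker_eq_bot']
    rintro ⟨A, hA⟩ hLA
    have hLA' : (L : Mat d T) * A = 0 := hLA
    apply Subtype.ext
    ext ⟨s, i⟩ ⟨t, j⟩
    by_cases hst : s = t
    · subst hst
      set x : Fin d → ℝ := fun k => A (s, k) (s, j) with hx
      have h1 : diagBlock ((L : Mat d T).transpose * (L : Mat d T)) s *ᵥ x = 0 := by
        ext i
        have h2 : ((L : Mat d T).transpose * ((L : Mat d T) * A)) (s, i) (s, j) = 0 := by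
          rw [hLA']; simp
        rw [← Matrix.mul_assoc, Matrix.mul_apply, Fintype.sum_prod_type,
          Finset.sum_eq_single s] at h2
        · exact h2
        · intro r _ hr
          exact Finset.sum_eq_zero fun k _ => by rw [hA (r, k) (s, j) hr, mul_zero]
        · simp
      by_contra hne
      have hx0 : x ≠ 0 := fun h => hne (congrFun h i)
      have h3 := (hL s).dotProduct_mulVec_pos hx0
      rw [h1] at h3
      simp at h3
    · exact hA _ _ hst
  obtain ⟨K, hK, hanti⟩ := f.exists_antilipschitzWith hf
  refine ⟨(K : ℝ)⁻¹, by positivity, fun O hO => ?_⟩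
  have h := hanti.le_mul_dist ⟨1 - O, one_sub_mem_diagSubmodule hO⟩ 0
  rw [map_zero, dist_zero_right, dist_zero_right] at h
  have hK' : (0 : ℝ) < K := hK
  rw [inv_mul_le_iff₀ hK']
  exact h

lemma blockDiag_isSymm {S : Fin T → Matrix (Fin d) (Fin d) ℝ} (hS : ∀ t, (S t).IsSymm) :
    (blockDiag S).IsSymm := by
  ext ⟨t, i⟩ ⟨s, j⟩
  by_cases h : t = s
  · subst h
    simpa [blockDiag] using (hS t).apply i j
  · simp [blockDiag, h, Ne.symm h]

lemma diagBlock_blockDiag (S : Fin T → Matrix (Fin d) (Fin d) ℝ) (t : Fin T) :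
    diagBlock (blockDiag S) t = S t := by
  ext i j
  simp [diagBlock, blockDiag]

/-- Horizontal vectors are orthogonal to the fibres up to second order. -/
lemma exists_abs_inner_le {L Z : lowerBlock d T} (hZ : Z ∈ calV L) :
    ∃ s : ℝ, 0 ≤ s ∧ ∀ O ∈ blockOrth d T,
      2 * |⟪(L : Mat d T) * (1 - O), (Z : Mat d T)⟫| ≤ s * ‖1 - O‖ ^ 2 := by
  set S : Fin T → Matrix (Fin d) (Fin d) ℝ :=
    fun t => diagBlock ((L : Mat d T).transpose * (Z : Mat d T)) t with hS
  have hSsymm (t : Fin T) : (S t).IsSymm := by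
    have h1 : S t = (diagBlock ((Z : Mat d T).transpose * (L : Mat d T)) t).transpose := by
      ext i j
      simp only [hS, diagBlock, Matrix.of_apply, Matrix.transpose_apply]
      rw [← Matrix.transpose_apply ((Z : Mat d T).transpose * _), Matrix.transpose_mul,
        Matrix.transpose_transpose]
    rw [h1]
    exact (hZ t).transpose
  refine ⟨‖blockDiag S‖, norm_nonneg _, fun O hO => ?_⟩
  have h1 : ⟪(L : Mat d T) * (1 - O), (Z : Mat d T)⟫ = ⟪1 - O, blockDiag S⟫ := by
    obtain ⟨P, -, rfl⟩ := hO
    have h2 : (1 : Mat d T) - blockDiag P = blockDiag fun t => 1 - P t := by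
      rw [← blockDiag_one]
      ext p q
      by_cases h : p.1 = q.1 <;> simp [blockDiag, h]
    rw [inner_mul_left, h2, inner_blockDiag, inner_blockDiag]
    simp only [diagBlock_blockDiag, hS]
  have h3 : ⟪(1 - O).transpose, blockDiag S⟫ = ⟪1 - O, blockDiag S⟫ := by
    rw [← inner_transpose, Matrix.transpose_transpose, (blockDiag_isSymm hSsymm).eq]
  have h4 : (1 - O).transpose * (1 - O) = (1 - O) + (1 - O).transpose := by
    have := blockOrth_transpose_mul hO
    rw [Matrix.transpose_sub, Matrix.transpose_one, sub_mul, mul_sub, mul_sub, this]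
    simp
    abel
  have h5 : 2 * ⟪1 - O, blockDiag S⟫ = ⟪(1 - O).transpose * (1 - O), blockDiag S⟫ := by
    rw [h4, inner_add_left, h3]; ring
  have h6 : 2 * |⟪1 - O, blockDiag S⟫| = |⟪(1 - O).transpose * (1 - O), blockDiag S⟫| := by
    rw [← h5, abs_mul, abs_two]
  rw [h1, h6]
  refine (abs_real_inner_le_norm _ _).trans ?_
  rw [mul_comm, sq]
  refine mul_le_mul_of_nonneg_left ?_ (norm_nonneg _)
  refine (Matrix.frobenius_norm_mul _ _).trans_eq ?_
  rw [Matrix.frobenius_norm_transpose]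

end Horizontal

/-! ### Second-order estimates near `L`. -/

section LocalEstimates

open scoped Matrix

variable {d T : ℕ}

local notation "⟪" x ", " y "⟫" => inner ℝ x y

lemma norm_sub_smul_sq {E : Type*} [NormedAddCommGroup E] [InnerProductSpace ℝ E] (a b : E)
    (r : ℝ) : ‖a - r • b‖ ^ 2 = ‖a‖ ^ 2 - 2 * r * ⟪a, b⟫ + r ^ 2 * ‖b‖ ^ 2 := by
  rw [norm_sub_sq_real, inner_smul_right, norm_smul, mul_pow, Real.norm_eq_abs, sq_abs]
  ring

lemma norm_add_smul_sq {E : Type*} [NormedAddCommGroup E] [InnerProductSpace ℝ E] (a b : E)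
    (r : ℝ) : ‖a + r • b‖ ^ 2 = ‖a‖ ^ 2 + 2 * r * ⟪a, b⟫ + r ^ 2 * ‖b‖ ^ 2 := by
  rw [norm_add_sq_real, inner_smul_right, norm_smul, mul_pow, Real.norm_eq_abs, sq_abs]
  ring

/-- Sufficiently short horizontal vectors are minimal. -/
lemma exists_smul_mem_bfV {Ω : Type*} [MeasurableSpace Ω] [StandardBorelSpace Ω]
    (B : GaussianBasis d T Ω) {L V : lowerBlock d T} (hL : IsReg L) (hV : V ∈ calV L) :
    ∃ r₀ : ℝ, 0 < r₀ ∧ ∀ r : ℝ, 0 ≤ r → r ≤ r₀ → r • V ∈ bfV L := by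
  obtain ⟨c, hc, hLc⟩ := exists_mul_norm_le hL
  obtain ⟨s, hs, hVs⟩ := exists_abs_inner_le hV
  -- Rotation by `O` gains at least `c² ‖1 - O‖²` and loses at most `r s ‖1 - O‖²`; this radius
  -- ensures `r s ≤ c²`.
  refine ⟨c ^ 2 / (s + 1), by positivity, fun r hr hr' => ?_⟩
  rw [mem_bfV_iff B, ← forall_norm_le_iff]
  intro O hO
  have hn : ‖r • V‖ = r * ‖(V : Mat d T)‖ := by
    rw [norm_smul, Real.norm_of_nonneg hr]
    rfl
  have e1 : (L : Mat d T) - ((L + r • V : lowerBlock d T) : Mat d T) * O =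
      (L : Mat d T) * (1 - O) - r • ((V : Mat d T) * O) := by
    rw [Submodule.coe_add, Submodule.coe_smul, Matrix.add_mul, Matrix.mul_sub, Matrix.mul_one,
      Matrix.smul_mul]
    abel
  -- Moving `O` across turns `1 - O` into `-(1 - Oᵀ)`, so the horizontality estimate applies to
  -- `Oᵀ`.
  have e2 : ⟪(L : Mat d T) * (1 - O), (V : Mat d T) * O⟫ =
      -⟪(L : Mat d T) * (1 - O.transpose), (V : Mat d T)⟫ := by
    rw [real_inner_comm, inner_mul_right, real_inner_comm, Matrix.mul_assoc, Matrix.sub_mul,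
      Matrix.one_mul, blockOrth_mul_transpose hO, ← inner_neg_left, ← Matrix.mul_neg, neg_sub]
  have e3 : ‖1 - O.transpose‖ = ‖1 - O‖ := by
    rw [← Matrix.frobenius_norm_transpose (1 - O), Matrix.transpose_sub, Matrix.transpose_one]
  have h1 := hVs _ (blockOrth_transpose_mem hO)
  rw [e3] at h1
  have h2 := pow_le_pow_left₀ (by positivity) (hLc O hO) 2
  rw [mul_pow] at h2
  rw [le_div_iff₀ (by positivity)] at hr'
  rw [hn, e1]
  refine abs_le_of_sq_le_sq' ?_ (norm_nonneg _) |>.2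
  rw [norm_sub_smul_sq, e2, norm_mul_blockOrth _ hO]
  have h4 := neg_abs_le ⟪(L : Mat d T) * (1 - O.transpose), (V : Mat d T)⟫
  have h5 : 0 ≤ (c ^ 2 - r * s) * ‖1 - O‖ ^ 2 :=
    mul_nonneg (by nlinarith) (by positivity)
  nlinarith [mul_le_mul_of_nonneg_left h4 hr, mul_le_mul_of_nonneg_left h1 hr]

/-- Half of `a² ≥ c² x² / 4` absorbs the term with `i`; completing the square in the other half
absorbs `2 u² k x` and leaves the `u⁴` error. -/
lemma quadratic_lower_bound {c s k u x a i j w : ℝ} (hc : 0 < c) (hu : 0 ≤ u) 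
    (hus : u * s ≤ c ^ 2 / 8) (ha : c / 2 * x ≤ a) (hx : 0 ≤ x)
    (hi : 2 * |i| ≤ s * x ^ 2) (hj : |j| ≤ k * x) :
    u ^ 2 * w - 8 * k ^ 2 / c ^ 2 * u ^ 4 ≤ a ^ 2 + 2 * u * (i + u * j) + u ^ 2 * w := by
  have h1 : (c / 2 * x) ^ 2 ≤ a ^ 2 := pow_le_pow_left₀ (by positivity) ha 2
  have h2 := neg_abs_le i
  have h3 := neg_abs_le j
  have h4 : u * (2 * |i|) ≤ c ^ 2 / 8 * x ^ 2 := by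
    calc u * (2 * |i|) ≤ u * (s * x ^ 2) := mul_le_mul_of_nonneg_left hi hu
      _ = u * s * x ^ 2 := by ring
      _ ≤ _ := mul_le_mul_of_nonneg_right hus (sq_nonneg x)
  have h5 : u * -|i| ≤ u * i := mul_le_mul_of_nonneg_left h2 hu
  have h6 : u ^ 2 * -(k * x) ≤ u ^ 2 * j := mul_le_mul_of_nonneg_left (by linarith) (sq_nonneg u)
  have h7 : 0 ≤ c ^ 2 / 8 * x ^ 2 - 2 * u ^ 2 * k * x + 8 * k ^ 2 / c ^ 2 * u ^ 4 := by
    have : c ^ 2 / 8 * x ^ 2 - 2 * u ^ 2 * k * x + 8 * k ^ 2 / c ^ 2 * u ^ 4 =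
        1 / 8 * (c * x - 8 * k * u ^ 2 / c) ^ 2 := by
      field_simp
      ring
    rw [this]
    positivity
  nlinarith

lemma exists_le_qdist_sq {Ω : Type*} [MeasurableSpace Ω] [StandardBorelSpace Ω]
    (B : GaussianBasis d T Ω) {L V W : lowerBlock d T} (hL : IsReg L) (hV : V ∈ calV L)
    (hW : W ∈ calV L) :
    ∃ C u₀ : ℝ, 0 < u₀ ∧ ∀ u : ℝ, 0 ≤ u → u ≤ u₀ →
      u ^ 2 * ‖V - W‖ ^ 2 - C * u ^ 4 ≤
        qdist B (toClass (L + u • V)) (toClass (L + u • W)) ^ 2 := by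
  obtain ⟨c, hc, hLc⟩ := exists_mul_norm_le hL
  obtain ⟨s, hs, hZs⟩ := exists_abs_inner_le (sub_mem hV hW)
  set w : ℝ := ‖(W : Mat d T)‖ with hw
  have hw0 : 0 ≤ w := norm_nonneg _
  set Z : Mat d T := ((V - W : lowerBlock d T) : Mat d T) with hZ
  -- The first bound on `u` gives `u w ≤ c / 2`, so `L + u W` keeps half the lower bound of `L`; the
  -- second gives `u s ≤ c² / 8`.
  refine ⟨8 * (w * ‖Z‖) ^ 2 / c ^ 2, min (c / 2 / (w + 1)) (c ^ 2 / 8 / (s + 1)),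
    by positivity, fun u hu hu' => ?_⟩
  have hu1 := hu'.trans (min_le_left _ _)
  have hu2 := hu'.trans (min_le_right _ _)
  rw [le_div_iff₀ (by positivity)] at hu1 hu2
  obtain ⟨M, hM, hq⟩ := exists_qdist_eq_norm B (L + u • V) (toClass (L + u • W))
  obtain ⟨O, hO, hMO⟩ := toClass_eq_iff.1 hM
  have e1 : ((L + u • V - M : lowerBlock d T) : Mat d T) =
      ((L : Mat d T) * (1 - O) + u • ((W : Mat d T) * (1 - O))) + u • Z := by
    rw [Submodule.coe_sub, hMO, hZ, Submodule.coe_sub, Submodule.coe_add, Submodule.coe_add,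
      Submodule.coe_smul, Submodule.coe_smul, Matrix.add_mul, Matrix.mul_sub, Matrix.mul_sub,
      Matrix.mul_one, Matrix.mul_one, Matrix.smul_mul, smul_sub, smul_sub]
    abel
  have e2 : qdist B (toClass (L + u • V)) (toClass (L + u • W)) =
      ‖((L : Mat d T) * (1 - O) + u • ((W : Mat d T) * (1 - O))) + u • Z‖ := by
    rw [hq, ← e1]
    rfl
  have e3 : ‖V - W‖ = ‖Z‖ := rfl
  rw [e2, e3, norm_add_smul_sq, inner_add_left, real_inner_smul_left]
  have h1 : ‖(W : Mat d T) * (1 - O)‖ ≤ w * ‖1 - O‖ := Matrix.frobenius_norm_mul _ _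
  have hx : 0 ≤ ‖1 - O‖ := norm_nonneg _
  refine quadratic_lower_bound (s := s) (x := ‖1 - O‖) hc hu (by nlinarith) ?_ hx (hZs O hO) ?_
  · have h2 := norm_sub_le_norm_add ((L : Mat d T) * (1 - O)) (u • ((W : Mat d T) * (1 - O)))
    rw [norm_smul, Real.norm_of_nonneg hu] at h2
    have h3 := hLc O hO
    have h4 := mul_le_mul_of_nonneg_left h1 hu
    have h5 : u * w ≤ c / 2 := by nlinarith
    have h6 := mul_le_mul_of_nonneg_right h5 hx
    linarith
  · refine (abs_real_inner_le_norm _ _).trans ?_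
    calc _ ≤ w * ‖1 - O‖ * ‖Z‖ := mul_le_mul_of_nonneg_right h1 (norm_nonneg _)
      _ = _ := by ring

end LocalEstimates

/-! ### Angles and cones in inner product spaces. -/

section AbstractAngles

variable {E : Type*} [NormedAddCommGroup E] [InnerProductSpace ℝ E]

/-- Chord is at most arc, from `1 - x² / 2 ≤ cos x`. It turns angle-Cauchy sequences of unit vectors
into norm-Cauchy ones. -/
lemma norm_sub_le_angle {v w : E} (hv : ‖v‖ = 1) (hw : ‖w‖ = 1) :
    ‖v - w‖ ≤ InnerProductGeometry.angle v w := by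
  have h1 := Real.one_sub_sq_div_two_le_cos (x := InnerProductGeometry.angle v w)
  rw [InnerProductGeometry.cos_angle, hv, hw, mul_one, div_one] at h1
  have h2 := norm_sub_sq_real v w
  rw [hv, hw] at h2
  refine abs_le_of_sq_le_sq' ?_ (InnerProductGeometry.angle_nonneg v w) |>.2
  linarith

lemma eq_of_angle_eq_zero {v w : E} (hv : ‖v‖ = 1) (hw : ‖w‖ = 1)
    (h : InnerProductGeometry.angle v w = 0) : v = w := by
  have h1 := norm_sub_le_angle hv hw
  rw [h] at h1
  exact sub_eq_zero.1 (norm_le_zero_iff.1 h1)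

lemma eq_of_angle_eq_zero_of_norm_eq {v w : E} (hv : v ≠ 0) (h : ‖v‖ = ‖w‖)
    (h' : InnerProductGeometry.angle v w = 0) : v = w := by
  obtain ⟨-, r, hr, rfl⟩ := InnerProductGeometry.angle_eq_zero_iff.1 h'
  rw [norm_smul, Real.norm_of_nonneg hr.le, eq_comm, mul_eq_right₀ (norm_ne_zero_iff.2 hv)] at h
  rw [h, one_smul]

lemma ne_zero_of_norm_eq_one {E : Type*} [NormedAddCommGroup E] {v : E} (hv : ‖v‖ = 1) : v ≠ 0 :=
  norm_ne_zero_iff.1 (hv.trans_ne one_ne_zero)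

lemma norm_smul_inv_norm_smul {v : E} (hv : v ≠ 0) : ‖v‖ • ‖v‖⁻¹ • v = v :=
  smul_inv_smul₀ (norm_ne_zero_iff.2 hv) v

lemma norm_smul_of_norm_eq_one {v : E} (hv : ‖v‖ = 1) (r : ℝ≥0) : ‖(r : ℝ) • v‖ = r := by
  rw [norm_smul, hv, mul_one, Real.norm_of_nonneg r.coe_nonneg]

lemma norm_inv_norm_smul {v : E} (hv : v ≠ 0) : ‖‖v‖⁻¹ • v‖ = 1 := norm_smul_inv_norm hv

lemma angle_inv_norm_smul {v w : E} (hv : v ≠ 0) (hw : w ≠ 0) :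
    InnerProductGeometry.angle (‖v‖⁻¹ • v) (‖w‖⁻¹ • w) = InnerProductGeometry.angle v w := by
  rw [InnerProductGeometry.angle_smul_left_of_pos _ _ (inv_pos.2 (norm_pos_iff.2 hv)),
    InnerProductGeometry.angle_smul_right_of_pos _ _ (inv_pos.2 (norm_pos_iff.2 hw))]

lemma exists_tendsto_of_cauchy_angle [FiniteDimensional ℝ E] {f : ℕ → E} (hf : ∀ n, ‖f n‖ = 1)
    (h : ∀ ε > 0, ∃ N, ∀ m ≥ N, ∀ n ≥ N, InnerProductGeometry.angle (f m) (f n) < ε) :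
    ∃ v, ‖v‖ = 1 ∧ Tendsto f atTop (𝓝 v) := by
  have := FiniteDimensional.complete ℝ E
  have hc : CauchySeq f := by
    rw [Metric.cauchySeq_iff]
    intro ε hε
    obtain ⟨N, hN⟩ := h ε hε
    refine ⟨N, fun m hm n hn => ?_⟩
    rw [dist_eq_norm]
    exact (norm_sub_le_angle (hf m) (hf n)).trans_lt (hN m hm n hn)
  obtain ⟨v, hv⟩ := cauchySeq_tendsto_of_complete hc
  refine ⟨v, ?_, hv⟩
  refine tendsto_nhds_unique hv.norm ?_
  simp [hf]

lemma tendsto_angle {f g : ℕ → E} {v w : E} (hv : ‖v‖ = 1) (hw : ‖w‖ = 1)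
    (hf : Tendsto f atTop (𝓝 v)) (hg : Tendsto g atTop (𝓝 w)) :
    Tendsto (fun n => InnerProductGeometry.angle (f n) (g n)) atTop
      (𝓝 (InnerProductGeometry.angle v w)) := by
  refine (Real.continuous_arccos.tendsto _).comp ((hf.inner hg).div (hf.norm.mul hg.norm) ?_)
  rw [hv, hw, mul_one]
  exact one_ne_zero

lemma sqrt_cone_formula {v w : E} (hv : ‖v‖ = 1) (hw : ‖w‖ = 1) (r s : ℝ) :
    √(r ^ 2 + s ^ 2 - 2 * r * s * Real.cos (InnerProductGeometry.angle v w)) =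
      ‖r • v - s • w‖ := by
  rw [← Real.sqrt_sq (norm_nonneg (r • v - s • w)), norm_sub_sq_real, norm_smul, norm_smul,
    real_inner_smul_left, real_inner_smul_right, InnerProductGeometry.cos_angle, hv, hw, mul_one,
    mul_one, mul_one, div_one, Real.norm_eq_abs, Real.norm_eq_abs, sq_abs, sq_abs]
  congr 1
  ring

lemma eq_and_eq_of_smul_eq_smul {v w : E} (hv : ‖v‖ = 1) (hw : ‖w‖ = 1) {r s : ℝ≥0}
    (h : (r : ℝ) • v = (s : ℝ) • w) : r = s ∧ (v = w ∨ s = 0) := by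
  have h1 := congrArg norm h
  rw [norm_smul, norm_smul, hv, hw, mul_one, mul_one, Real.norm_of_nonneg r.coe_nonneg,
    Real.norm_of_nonneg s.coe_nonneg] at h1
  have h2 : r = s := NNReal.coe_injective h1
  subst h2
  refine ⟨rfl, or_iff_not_imp_right.2 fun h0 => ?_⟩
  exact smul_right_injective E (NNReal.coe_ne_zero.2 h0) h

end AbstractAngles

/-! ### The angle between geodesics. -/

section Angle

variable {d T : ℕ} {Ω : Type*} [MeasurableSpace Ω] [StandardBorelSpace Ω] {B : GaussianBasis d T Ω}

instance neBot_nhdsGT_zero : (𝓝[>] (0 : unitInterval)).NeBot :=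
  nhdsGT_neBot_of_exists_gt ⟨1, zero_lt_one⟩

lemma norm_sub_sq_eq_angle {E : Type*} [NormedAddCommGroup E] [InnerProductSpace ℝ E] (v w : E) :
    (‖v‖ ^ 2 + ‖w‖ ^ 2 - ‖v - w‖ ^ 2) / (2 * ‖v‖ * ‖w‖) = inner ℝ v w / (‖v‖ * ‖w‖) := by
  rw [norm_sub_sq_real]
  rw [show ‖v‖ ^ 2 + ‖w‖ ^ 2 - (‖v‖ ^ 2 - 2 * inner ℝ v w + ‖w‖ ^ 2) = 2 * inner ℝ v w by ring,
    mul_assoc, mul_div_mul_left _ _ two_ne_zero]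

lemma norm_add_smul_sub_add_smul_of_nonneg {E : Type*} [NormedAddCommGroup E] [NormedSpace ℝ E]
    (x v w : E) {u : ℝ} (hu : 0 ≤ u) : ‖(x + u • v) - (x + u • w)‖ = u * ‖v - w‖ := by
  rw [add_sub_add_left_eq_sub, ← smul_sub, norm_smul, Real.norm_of_nonneg hu]

lemma qdist_segment_zero (B : GaussianBasis d T Ω) {L V : lowerBlock d T} (hV : V ∈ bfV L)
    (u : unitInterval) : qdist B (toClass L) (toClass (L + (u : ℝ) • V)) = u * ‖V‖ := by
  have h := qdist_segment B hV 0 u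
  have h0 : toClass (L + ((0 : unitInterval) : ℝ) • V) = toClass L :=
    congrArg toClass (add_zero_smul L V)
  have h1 : |((0 : unitInterval) : ℝ) - u| = u := by
    rw [Set.Icc.coe_zero, zero_sub, abs_neg, abs_of_nonneg u.2.1]
  rwa [h0, h1] at h

/-- The denominator is of order `u²`, so the `u⁴` error still vanishes in the limit. -/
lemma compCos_bounds {u a b z q C : ℝ} (hu : 0 < u) (ha : 0 < a) (hb : 0 < b)
    (h₁ : u ^ 2 * z - C * u ^ 4 ≤ q) (h₂ : q ≤ u ^ 2 * z) :
    (a ^ 2 + b ^ 2 - z) / (2 * a * b) ≤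
        ((u * a) ^ 2 + (u * b) ^ 2 - q) / (2 * (u * a) * (u * b)) ∧
      ((u * a) ^ 2 + (u * b) ^ 2 - q) / (2 * (u * a) * (u * b)) ≤
        (a ^ 2 + b ^ 2 - z + C * u ^ 2) / (2 * a * b) := by
  constructor
  · rw [div_le_div_iff₀ (by positivity) (by positivity)]
    have : 0 ≤ (2 * a * b) * (u ^ 2 * z - q) := mul_nonneg (by positivity) (by linarith)
    nlinarith
  · rw [div_le_div_iff₀ (by positivity) (by positivity)]
    have : 0 ≤ (2 * a * b) * (q - (u ^ 2 * z - C * u ^ 4)) :=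
      mul_nonneg (by positivity) (by linarith)
    nlinarith

/-- The angle between two geodesics is the Frobenius angle between their horizontal lifts. -/
lemma angle_eq {L V W : lowerBlock d T} (hL : IsReg L) (hV : V ∈ bfV L) (hW : W ∈ bfV L)
    (hV0 : V ≠ 0) (hW0 : W ≠ 0) {γ η : NCGeod B (toClass L)}
    (hγ : ∀ u : unitInterval, γ.1.1 u = toClass (L + (u : ℝ) • V))
    (hη : ∀ u : unitInterval, η.1.1 u = toClass (L + (u : ℝ) • W)) :
    angle γ η = InnerProductGeometry.angle V W := by
  obtain ⟨C, u₀, hu₀, hC⟩ := exists_le_qdist_sq B hL (bfV_subset_calV hV) (bfV_subset_calV hW)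
  have hv : 0 < ‖V‖ := norm_pos_iff.2 hV0
  have hw : 0 < ‖W‖ := norm_pos_iff.2 hW0
  unfold angle InnerProductGeometry.angle
  rw [← norm_sub_sq_eq_angle V W]
  congr 1
  refine Tendsto.limUnder_eq ?_
  have hcoe : Tendsto (fun u : unitInterval => (u : ℝ)) (𝓝[>] 0) (𝓝 0) :=
    (continuous_subtype_val.tendsto' (0 : unitInterval) 0 rfl).mono_left nhdsWithin_le_nhds
  have hup : Tendsto (fun u : unitInterval => (‖V‖ ^ 2 + ‖W‖ ^ 2 - ‖V - W‖ ^ 2 + C * (u : ℝ) ^ 2) /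
      (2 * ‖V‖ * ‖W‖)) (𝓝[>] 0) (𝓝 ((‖V‖ ^ 2 + ‖W‖ ^ 2 - ‖V - W‖ ^ 2) / (2 * ‖V‖ * ‖W‖))) := by
    have h := ((hcoe.pow 2).const_mul C).const_add (‖V‖ ^ 2 + ‖W‖ ^ 2 - ‖V - W‖ ^ 2)
    have h' := h.div_const (2 * ‖V‖ * ‖W‖)
    rwa [zero_pow two_ne_zero, mul_zero, add_zero] at h'
  have hb : ∀ᶠ u : unitInterval in 𝓝[>] 0,
      (‖V‖ ^ 2 + ‖W‖ ^ 2 - ‖V - W‖ ^ 2) / (2 * ‖V‖ * ‖W‖) ≤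
        compCos B (toClass L) (γ.1.1 u) (η.1.1 u) ∧
      compCos B (toClass L) (γ.1.1 u) (η.1.1 u) ≤
        (‖V‖ ^ 2 + ‖W‖ ^ 2 - ‖V - W‖ ^ 2 + C * (u : ℝ) ^ 2) / (2 * ‖V‖ * ‖W‖) := by
    filter_upwards [hcoe.eventually_lt_const hu₀, self_mem_nhdsWithin] with u hu hu'
    have hu0 : (0 : ℝ) < u := hu'
    unfold compCos
    rw [hγ, hη, qdist_segment_zero B hV, qdist_segment_zero B hW]
    refine compCos_bounds hu0 hv hw (hC u hu0.le hu.le) ?_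
    have h1 := qdist_le_norm B (L + (u : ℝ) • V) (L + (u : ℝ) • W)
    have h2 : ‖(L + (u : ℝ) • V) - (L + (u : ℝ) • W)‖ = u * ‖V - W‖ :=
      norm_add_smul_sub_add_smul_of_nonneg L V W hu0.le
    rw [h2] at h1
    have h3 : 0 ≤ qdist B (toClass (L + (u : ℝ) • V)) (toClass (L + (u : ℝ) • W)) := by
      obtain ⟨M, -, h⟩ := exists_qdist_eq_norm B (L + (u : ℝ) • V) (toClass (L + (u : ℝ) • W))
      rw [h]
      exact norm_nonneg _
    rw [← mul_pow]
    exact pow_le_pow_left₀ h3 h1 2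
  exact tendsto_of_tendsto_of_tendsto_of_le_of_le' tendsto_const_nhds hup
    (hb.mono fun _ h => h.1) (hb.mono fun _ h => h.2)

end Angle

/-! ### The space of directions is the unit sphere of `𝒱(L)`. -/

section Directions

variable {d T : ℕ} {Ω : Type*} [MeasurableSpace Ω] [StandardBorelSpace Ω] {B : GaussianBasis d T Ω}
  {L : lowerBlock d T}

lemma ne_zero_of_not_isConst {γ : Geod B (toClass L)} (hc : ¬ IsConst γ) {V : lowerBlock d T}
    (h : ∀ u : unitInterval, γ.1 u = toClass (L + (u : ℝ) • V)) : V ≠ 0 := by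
  rintro rfl
  refine hc fun u => ?_
  rw [h u, smul_zero, add_zero]

lemma exists_vel (γ : NCGeod B (toClass L)) : ∃ V : calV L, (V : lowerBlock d T) ∈ bfV L ∧ V ≠ 0 ∧
    ∀ u : unitInterval, γ.1.1 u = toClass (L + (u : ℝ) • (V : lowerBlock d T)) := by
  obtain ⟨V, hV, h⟩ := exists_segment B γ.1
  refine ⟨⟨V, bfV_subset_calV hV⟩, hV, fun h0 => ?_, h⟩
  exact ne_zero_of_not_isConst γ.2 h (congrArg Subtype.val h0)

/-- The horizontal lift of the initial velocity of a geodesic. -/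
def vel (γ : NCGeod B (toClass L)) : calV L := (exists_vel γ).choose

lemma vel_mem (γ : NCGeod B (toClass L)) : (vel γ : lowerBlock d T) ∈ bfV L :=
  (exists_vel γ).choose_spec.1

lemma vel_ne_zero (γ : NCGeod B (toClass L)) : vel γ ≠ 0 := (exists_vel γ).choose_spec.2.1

lemma vel_spec (γ : NCGeod B (toClass L)) (u : unitInterval) :
    γ.1.1 u = toClass (L + (u : ℝ) • (vel γ : lowerBlock d T)) :=
  (exists_vel γ).choose_spec.2.2 u

lemma angle_eq_angle_of_rep (hL : IsReg L) {V W : calV L} (hV : (V : lowerBlock d T) ∈ bfV L)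
    (hW : (W : lowerBlock d T) ∈ bfV L) (hV0 : V ≠ 0) (hW0 : W ≠ 0) {γ η : NCGeod B (toClass L)}
    (hγ : ∀ u : unitInterval, γ.1.1 u = toClass (L + (u : ℝ) • (V : lowerBlock d T)))
    (hη : ∀ u : unitInterval, η.1.1 u = toClass (L + (u : ℝ) • (W : lowerBlock d T))) :
    angle γ η = InnerProductGeometry.angle V W :=
  angle_eq hL hV hW (fun h => hV0 (Subtype.ext h)) (fun h => hW0 (Subtype.ext h)) hγ hη

lemma norm_eq_qdist_of_rep {V : lowerBlock d T} (hV : V ∈ bfV L) {γ : Geod B (toClass L)}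
    (hγ : ∀ u : unitInterval, γ.1 u = toClass (L + (u : ℝ) • V)) :
    qdist B (toClass L) (γ.1 1) = ‖V‖ := by
  rw [hγ, qdist_segment_zero B hV, Set.Icc.coe_one, one_mul]

lemma vel_eq (hL : IsReg L) {V : calV L} (hV : (V : lowerBlock d T) ∈ bfV L) (hV0 : V ≠ 0)
    {γ : NCGeod B (toClass L)}
    (hγ : ∀ u : unitInterval, γ.1.1 u = toClass (L + (u : ℝ) • (V : lowerBlock d T))) :
    vel γ = V := by
  -- Evaluating the angle of `γ` with itself through two lifts shows that the lifts enclose angle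
  -- zero; their norms agree with the length of `γ`.
  have h1 := angle_eq_angle_of_rep hL (vel_mem γ) hV (vel_ne_zero γ) hV0 (vel_spec γ) hγ
  have h2 := angle_eq_angle_of_rep hL (vel_mem γ) (vel_mem γ) (vel_ne_zero γ) (vel_ne_zero γ)
    (vel_spec γ) (vel_spec γ)
  rw [InnerProductGeometry.angle_self (vel_ne_zero γ)] at h2
  refine eq_of_angle_eq_zero_of_norm_eq (vel_ne_zero γ) ?_ (h1.symm.trans h2)
  exact (norm_eq_qdist_of_rep (vel_mem γ) (vel_spec γ)).symm.trans (norm_eq_qdist_of_rep hV hγ)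

/-- The unit horizontal vector in the direction of a geodesic. -/
def dir (γ : NCGeod B (toClass L)) : calV L := ‖vel γ‖⁻¹ • vel γ

lemma norm_dir (γ : NCGeod B (toClass L)) : ‖dir γ‖ = 1 := by
  unfold dir
  exact norm_inv_norm_smul (v := vel γ) (vel_ne_zero γ)

lemma angle_eq_angle_dir (hL : IsReg L) (γ η : NCGeod B (toClass L)) :
    angle γ η = InnerProductGeometry.angle (dir γ) (dir η) :=
  (angle_eq_angle_of_rep hL (vel_mem γ) (vel_mem η) (vel_ne_zero γ) (vel_ne_zero η) (vel_spec γ)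
    (vel_spec η)).trans (angle_inv_norm_smul (vel_ne_zero γ) (vel_ne_zero η)).symm

lemma exists_tendsto_dir (hL : IsReg L) (s : CauchyDir B (toClass L)) :
    ∃ v : calV L, ‖v‖ = 1 ∧ Tendsto (fun n => dir (s.1 n)) atTop (𝓝 v) := by
  refine exists_tendsto_of_cauchy_angle (fun n => norm_dir _) fun ε hε => ?_
  obtain ⟨N, hN⟩ := s.2 ε hε
  refine ⟨N, fun m hm n hn => ?_⟩
  rw [← angle_eq_angle_dir hL]
  exact hN m hm n hn

/-- The limit direction of a Cauchy sequence of geodesics. -/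
def limDir (hL : IsReg L) (s : CauchyDir B (toClass L)) : calV L :=
  (exists_tendsto_dir hL s).choose

lemma norm_limDir (hL : IsReg L) (s : CauchyDir B (toClass L)) : ‖limDir hL s‖ = 1 :=
  (exists_tendsto_dir hL s).choose_spec.1

lemma tendsto_limDir (hL : IsReg L) (s : CauchyDir B (toClass L)) :
    Tendsto (fun n => dir (s.1 n)) atTop (𝓝 (limDir hL s)) :=
  (exists_tendsto_dir hL s).choose_spec.2

lemma tendsto_angle_limDir (hL : IsReg L) (s t : CauchyDir B (toClass L)) :
    Tendsto (fun n => angle (s.1 n) (t.1 n)) atTop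
      (𝓝 (InnerProductGeometry.angle (limDir hL s) (limDir hL t))) :=
  (tendsto_angle (norm_limDir hL s) (norm_limDir hL t) (tendsto_limDir hL s)
    (tendsto_limDir hL t)).congr fun _ => (angle_eq_angle_dir hL _ _).symm

/-- The unit horizontal vector of a direction. -/
def dirVec (hL : IsReg L) (θ : Dir B (toClass L)) : calV L :=
  Quot.lift (limDir hL) (fun s t h => eq_of_angle_eq_zero (norm_limDir hL s) (norm_limDir hL t)
    (tendsto_nhds_unique (tendsto_angle_limDir hL s t) h)) θ

lemma norm_dirVec (hL : IsReg L) (θ : Dir B (toClass L)) : ‖dirVec hL θ‖ = 1 := by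
  induction θ using Quot.ind with
  | mk s => exact norm_limDir hL s

lemma dirVec_injective (hL : IsReg L) :
    Function.Injective (dirVec hL : Dir B (toClass L) → calV L) := by
  intro θ φ
  induction θ using Quot.ind with
  | mk s =>
  induction φ using Quot.ind with
  | mk t =>
  intro h
  apply Quot.sound
  have h1 := tendsto_angle_limDir hL s t
  have h2 : limDir hL s = limDir hL t := h
  rwa [← h2, InnerProductGeometry.angle_self (ne_zero_of_norm_eq_one (norm_limDir hL s))] at h1

lemma dirAngle_eq (hL : IsReg L) (θ φ : Dir B (toClass L)) :
    Dir.angle θ φ = InnerProductGeometry.angle (dirVec hL θ) (dirVec hL φ) := by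
  have h (θ : Dir B (toClass L)) : dirVec hL θ = limDir hL (Quot.out θ) :=
    congrArg (dirVec hL) (Quot.out_eq θ).symm
  rw [h, h]
  exact (tendsto_angle_limDir hL _ _).limUnder_eq

lemma angle_self (hL : IsReg L) (γ : NCGeod B (toClass L)) : angle γ γ = 0 := by
  rw [angle_eq_angle_dir hL]
  exact InnerProductGeometry.angle_self (ne_zero_of_norm_eq_one (norm_dir γ))

lemma isDirOf_iff (hL : IsReg L) {θ : Dir B (toClass L)} {γ : NCGeod B (toClass L)} :
    IsDirOf θ γ ↔ dirVec hL θ = dir γ := by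
  have key (s : CauchyDir B (toClass L)) (hs : ∀ n, s.1 n = γ) : limDir hL s = dir γ := by
    refine tendsto_nhds_unique (tendsto_limDir hL s) ?_
    simp only [hs]
    exact tendsto_const_nhds
  constructor
  · rintro ⟨s, hs, rfl⟩
    exact key s hs
  · intro h
    refine ⟨⟨fun _ => γ, fun ε hε => ⟨0, fun m _ n _ => ?_⟩⟩, fun _ => rfl, ?_⟩
    · rwa [angle_self hL]
    · apply dirVec_injective hL
      rw [h]
      exact (key _ fun _ => rfl).symm

lemma dir_eq (hL : IsReg L) {V : calV L} (hV : (V : lowerBlock d T) ∈ bfV L) (hV0 : V ≠ 0)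
    {γ : NCGeod B (toClass L)}
    (hγ : ∀ u : unitInterval, γ.1.1 u = toClass (L + (u : ℝ) • (V : lowerBlock d T))) :
    dir γ = ‖V‖⁻¹ • V := by
  rw [dir, vel_eq hL hV hV0 hγ]

lemma not_isConst_segGeod {V : calV L} (hV : (V : lowerBlock d T) ∈ bfV L) (hV0 : V ≠ 0) :
    ¬ IsConst (segGeod B hV) := by
  intro h
  have h1 := norm_eq_qdist_of_rep hV (γ := segGeod B hV) fun _ => rfl
  rw [h 1, qdist_self] at h1
  exact hV0 (Subtype.ext (norm_eq_zero.1 h1.symm))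

lemma dir_segGeod (hL : IsReg L) {V : calV L} (hV : (V : lowerBlock d T) ∈ bfV L) (hV0 : V ≠ 0) :
    dir ⟨segGeod B hV, not_isConst_segGeod hV hV0⟩ = ‖V‖⁻¹ • V :=
  dir_eq hL hV hV0 fun _ => rfl

lemma inv_norm_smul_smul {E : Type*} [NormedAddCommGroup E] [NormedSpace ℝ E] {v : E}
    (hv : ‖v‖ = 1) {r : ℝ} (hr : 0 < r) : ‖r • v‖⁻¹ • r • v = v := by
  rw [norm_smul, hv, mul_one, Real.norm_of_nonneg hr.le, inv_smul_smul₀ hr.ne']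

/-- Every unit horizontal vector is the direction of a short geodesic. -/
lemma exists_dir_eq (B : GaussianBasis d T Ω) (hL : IsReg L) {v : calV L} (hv : ‖v‖ = 1) :
    ∃ V : calV L, (V : lowerBlock d T) ∈ bfV L ∧ V ≠ 0 ∧ ∃ γ : NCGeod B (toClass L),
      (∀ u : unitInterval, γ.1.1 u = toClass (L + (u : ℝ) • (V : lowerBlock d T))) ∧
      dir γ = v := by
  obtain ⟨r, hr, h⟩ := exists_smul_mem_bfV B hL v.2
  have hV : ((r • v : calV L) : lowerBlock d T) ∈ bfV L := h r hr.le le_rfl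
  have hv0 : v ≠ 0 := ne_zero_of_norm_eq_one hv
  have hV0 : r • v ≠ 0 := smul_ne_zero hr.ne' hv0
  refine ⟨r • v, hV, hV0, ⟨segGeod B hV, not_isConst_segGeod hV hV0⟩, fun _ => rfl, ?_⟩
  rw [dir_segGeod hL hV hV0]
  exact inv_norm_smul_smul hv hr

lemma exists_dirVec_eq (B : GaussianBasis d T Ω) (hL : IsReg L) {v : calV L} (hv : ‖v‖ = 1) :
    ∃ θ : Dir B (toClass L), dirVec hL θ = v := by
  obtain ⟨V, -, -, γ, -, h⟩ := exists_dir_eq B hL hv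
  have hc : ∀ ε > 0, ∃ N, ∀ m ≥ N, ∀ n ≥ N,
      angle ((fun _ : ℕ => γ) m) ((fun _ : ℕ => γ) n) < ε := fun ε hε =>
    ⟨0, fun _ _ _ _ => by rwa [angle_self hL]⟩
  refine ⟨Quot.mk _ ⟨fun _ => γ, hc⟩, ?_⟩
  refine Eq.trans ((isDirOf_iff hL).1 ?_) h
  exact ⟨⟨fun _ => γ, hc⟩, fun _ => rfl, rfl⟩

end Directions

/-! ### The tangent cone and the exponential map. -/

section Cone

variable {d T : ℕ} {Ω : Type*} [MeasurableSpace Ω] [StandardBorelSpace Ω]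

lemma self_mem_calV (L : lowerBlock d T) : L ∈ calV L := by
  intro t
  ext i j
  simp only [diagBlock, Matrix.of_apply, Matrix.transpose_apply]
  rw [← Matrix.transpose_apply ((L : Mat d T).transpose * _), Matrix.transpose_mul,
    Matrix.transpose_transpose]

lemma ne_zero_of_isReg (hd : 0 < d) (hT : 0 < T) {L : lowerBlock d T} (hL : IsReg L) : L ≠ 0 := by
  rintro rfl
  have h := (hL ⟨0, hT⟩).diag_pos (i := (⟨0, hd⟩ : Fin d))
  simp [diagBlock] at h

/-- As a quotient of pairs, the cone has a tip only if some direction exists; `L` itself is a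
nonzero horizontal vector. -/
lemma nonempty_dir (hd : 0 < d) (hT : 0 < T) (B : GaussianBasis d T Ω) {L : lowerBlock d T}
    (hL : IsReg L) : Nonempty (Dir B (toClass L)) := by
  have h0 : (⟨L, self_mem_calV L⟩ : calV L) ≠ 0 := fun h =>
    ne_zero_of_isReg hd hT hL (congrArg Subtype.val h)
  exact ⟨(exists_dirVec_eq B hL (norm_inv_norm_smul h0)).choose⟩

variable {B : GaussianBasis d T Ω} {L : lowerBlock d T}

/-- The map `(θ, r) ↦ r θ` from the tangent cone to the horizontal space. -/
def coneMap (hL : IsReg L) (ξ : TangentCone B (toClass L)) : calV L :=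
  Quotient.lift (s := tipSetoid B (toClass L)) (fun a => (a.2 : ℝ) • dirVec hL a.1) (by
    rintro a b (rfl | ⟨h₁, h₂⟩)
    · rfl
    · simp only [h₁, h₂, NNReal.coe_zero, zero_smul]) ξ

lemma coneMap_mk (hL : IsReg L) (θ : Dir B (toClass L)) (r : ℝ≥0) :
    coneMap hL (TangentCone.mk θ r) = (r : ℝ) • dirVec hL θ := rfl

lemma TangentCone.exists_mk_eq (ξ : TangentCone B (toClass L)) :
    ∃ θ r, ξ = TangentCone.mk θ r := by
  obtain ⟨a, rfl⟩ := Quotient.exists_rep (s := tipSetoid B (toClass L)) ξ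
  exact ⟨a.1, a.2, rfl⟩

lemma coneMap_injective (hL : IsReg L) :
    Function.Injective (coneMap hL : TangentCone B (toClass L) → calV L) := by
  intro ξ ζ h
  obtain ⟨θ, r, rfl⟩ := ξ.exists_mk_eq
  obtain ⟨φ, s, rfl⟩ := ζ.exists_mk_eq
  rw [coneMap_mk, coneMap_mk] at h
  obtain ⟨rfl, h | h⟩ := eq_and_eq_of_smul_eq_smul (norm_dirVec hL θ) (norm_dirVec hL φ) h
  · rw [dirVec_injective hL h]
  · exact Quotient.sound (s := tipSetoid B (toClass L)) (Or.inr ⟨h, h⟩)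

lemma coneMap_surjective (hd : 0 < d) (hT : 0 < T) (hL : IsReg L) :
    Function.Surjective (coneMap hL : TangentCone B (toClass L) → calV L) := by
  intro V
  by_cases hV : V = 0
  · obtain ⟨θ⟩ := nonempty_dir hd hT B hL
    exact ⟨TangentCone.mk θ 0, by rw [coneMap_mk, NNReal.coe_zero, zero_smul, hV]⟩
  · obtain ⟨θ, h⟩ := exists_dirVec_eq B hL (norm_inv_norm_smul hV)
    refine ⟨TangentCone.mk θ ‖V‖₊, ?_⟩
    rw [coneMap_mk, h, coe_nnnorm]
    exact norm_smul_inv_norm_smul (v := V) hV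

/-- The tangent cone is the horizontal space. -/
def coneEquiv (hd : 0 < d) (hT : 0 < T) (B : GaussianBasis d T Ω) (hL : IsReg L) :
    TangentCone B (toClass L) ≃ calV L :=
  Equiv.ofBijective (coneMap hL) ⟨coneMap_injective hL, coneMap_surjective hd hT hL⟩

lemma dist_eq_norm_coneMap (hL : IsReg L) (ξ ζ : TangentCone B (toClass L)) :
    TangentCone.dist ξ ζ = ‖coneMap hL ξ - coneMap hL ζ‖ := by
  obtain ⟨θ, r, rfl⟩ := ξ.exists_mk_eq
  obtain ⟨φ, s, rfl⟩ := ζ.exists_mk_eq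
  rw [coneMap_mk, coneMap_mk, ← sqrt_cone_formula (norm_dirVec hL θ) (norm_dirVec hL φ),
    ← dirAngle_eq hL]
  rfl

lemma isCanonical_coneEquiv (hd : 0 < d) (hT : 0 < T) (hL : IsReg L) :
    IsCanonical B L (coneEquiv hd hT B hL) := by
  intro V hV hV0 γ hγ θ hθ r
  have h0 : (⟨V, bfV_subset_calV hV⟩ : calV L) ≠ 0 := fun h => hV0 (congrArg Subtype.val h)
  have h1 : coneMap hL (TangentCone.mk θ r) = ((r : ℝ) / ‖V‖) • ⟨V, bfV_subset_calV hV⟩ := by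
    rw [coneMap_mk, (isDirOf_iff hL).1 hθ, dir_eq hL (V := ⟨V, bfV_subset_calV hV⟩) hV h0 hγ,
      div_eq_mul_inv, mul_smul]
    rfl
  exact congrArg Subtype.val h1

/-- Since every direction is that of a genuine geodesic, the canonical formula prescribes the value
at every point of the cone. -/
lemma eq_of_isCanonical (hL : IsReg L) {ι ι' : TangentCone B (toClass L) ≃ calV L}
    (h : IsCanonical B L ι) (h' : IsCanonical B L ι') : ι' = ι := by
  ext1 ξ
  obtain ⟨θ, r, rfl⟩ := ξ.exists_mk_eq
  obtain ⟨V, hV, hV0, γ, hγ, hdir⟩ := exists_dir_eq B hL (norm_dirVec hL θ)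
  have hθ : IsDirOf θ γ := (isDirOf_iff hL).2 hdir.symm
  have h0 : (V : lowerBlock d T) ≠ 0 := fun h => hV0 (Subtype.ext h)
  exact Subtype.ext ((h' V hV h0 γ hγ θ hθ r).trans (h V hV h0 γ hγ θ hθ r).symm)

lemma hasInitialVelocity_segGeod (hL : IsReg L) {U : calV L} (hU : (U : lowerBlock d T) ∈ bfV L)
    {ξ : TangentCone B (toClass L)} (hξ : coneMap hL ξ = U) :
    HasInitialVelocity (segGeod B hU) ξ := by
  obtain ⟨θ, r, rfl⟩ := ξ.exists_mk_eq
  rw [coneMap_mk] at hξ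
  have hr : ‖U‖ = r := by
    rw [← hξ]
    exact norm_smul_of_norm_eq_one (norm_dirVec hL θ) r
  refine ⟨θ, r, rfl, (norm_eq_qdist_of_rep hU fun _ => rfl).trans hr, fun h => ?_⟩
  have hU0 : U ≠ 0 := fun h0 =>
    ne_zero_of_not_isConst h (V := (U : lowerBlock d T)) (fun _ => rfl) (congrArg Subtype.val h0)
  have hr0 : (r : ℝ) ≠ 0 := by
    rw [← hr]
    exact norm_ne_zero_iff (a := U).2 hU0
  refine (isDirOf_iff hL).2 (Eq.trans ?_ (dir_segGeod hL hU hU0).symm)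
  rw [hr, ← hξ, inv_smul_smul₀ hr0]

lemma eq_segGeod_of_hasInitialVelocity (hL : IsReg L) {U : calV L}
    (hU : (U : lowerBlock d T) ∈ bfV L) {ξ : TangentCone B (toClass L)} (hξ : coneMap hL ξ = U)
    {η : Geod B (toClass L)} (hη : HasInitialVelocity η ξ) : η = segGeod B hU := by
  obtain ⟨θ, r, rfl, hr, hθ⟩ := hη
  rw [coneMap_mk] at hξ
  obtain ⟨V, hV, hηV⟩ := exists_segment B η
  suffices h : U = (⟨V, bfV_subset_calV hV⟩ : calV L) by
    subst h
    exact Subtype.ext (funext hηV)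
  have hr' : r = ‖V‖ := hr.symm.trans (norm_eq_qdist_of_rep hV hηV)
  rw [← hξ, hr']
  -- A constant geodesic carries no direction, so `θ` is arbitrary; its length zero already
  -- identifies both vectors with `0`.
  by_cases hc : IsConst η
  · have h0 : ‖V‖ = 0 := by rw [← norm_eq_qdist_of_rep hV hηV, hc 1, qdist_self]
    rw [h0, zero_smul]
    exact Subtype.ext (norm_eq_zero.1 h0).symm
  · have h0 : (⟨V, bfV_subset_calV hV⟩ : calV L) ≠ 0 := fun h =>
      ne_zero_of_not_isConst hc hηV (congrArg Subtype.val h)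
    rw [((isDirOf_iff hL).1 (hθ hc)).trans
      (dir_eq hL (V := ⟨V, bfV_subset_calV hV⟩) (γ := ⟨η, hc⟩) hV h0 hηV)]
    exact norm_smul_inv_norm_smul (v := (⟨V, bfV_subset_calV hV⟩ : calV L)) h0

lemma toClass_add_mem_expMap (hL : IsReg L) {U : calV L} (hU : (U : lowerBlock d T) ∈ bfV L)
    {ξ : TangentCone B (toClass L)} (hξ : coneMap hL ξ = U) :
    toClass (L + (U : lowerBlock d T)) ∈ expMap B (toClass L) ξ := by
  have hdom : ∃! η : Geod B (toClass L), HasInitialVelocity η ξ :=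
    ⟨segGeod B hU, hasInitialVelocity_segGeod hL hU hξ, fun _ h =>
      eq_segGeod_of_hasInitialVelocity hL hU hξ h⟩
  refine ⟨hdom, ?_⟩
  have h1 : hdom.choose = segGeod B hU :=
    eq_segGeod_of_hasInitialVelocity hL hU hξ hdom.choose_spec.1
  change hdom.choose.1 1 = _
  rw [h1]
  change toClass (L + ((1 : unitInterval) : ℝ) • (U : lowerBlock d T)) = _
  rw [Set.Icc.coe_one, one_smul]

end Cone

end ABW

end

theorem proposition1p4 {d T : ℕ} (hd : 0 < d) (hT : 0 < T)
    {Ω : Type*} [MeasurableSpace Ω] [StandardBorelSpace Ω] (B : ABW.GaussianBasis d T Ω)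
    (L : ABW.lowerBlock d T) (hL : ABW.IsReg L) :
    ∃ ι : ABW.TangentCone B (ABW.toClass L) ≃ ABW.calV L,
      ABW.IsCanonical B L ι ∧
      (∀ ι' : ABW.TangentCone B (ABW.toClass L) ≃ ABW.calV L,
        ABW.IsCanonical B L ι' → ι' = ι) ∧
      (∀ ξ ζ : ABW.TangentCone B (ABW.toClass L),
        ABW.TangentCone.dist ξ ζ = ‖ι ξ - ι ζ‖) ∧
      ∀ V : ABW.calV L, ∃ r₀ : ℝ, 0 < r₀ ∧ ∀ r : ℝ, 0 ≤ r → r ≤ r₀ →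
        ABW.toClass (L + r • (V : ABW.lowerBlock d T)) ∈
          ABW.expMap B (ABW.toClass L) (ι.symm (r • V)) := by
  have hcan := ABW.isCanonical_coneEquiv (B := B) hd hT hL
  refine ⟨ABW.coneEquiv hd hT B hL, hcan, fun ι' h => ABW.eq_of_isCanonical hL hcan h,
    ABW.dist_eq_norm_coneMap hL, fun V => ?_⟩
  obtain ⟨r₀, hr₀, h⟩ := ABW.exists_smul_mem_bfV B hL V.2
  exact ⟨r₀, hr₀, fun r hr hr' => ABW.toClass_add_mem_expMap hL (U := r • V) (h r hr hr')
    ((ABW.coneEquiv hd hT B hL).apply_symm_apply (r • V))⟩
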